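/- Let $G$ be a locally compact (Hausdorff) group and let $H<G$ be a closed subgroup. A convex compact $G$-space is a compact convex subset $K$ of a Hausdorff locally convex real topological vector space $E$, together with an affine representation of $G$ on $E$ by continuous affine automorphisms which preserves $K$ and for which the action map $G\times K\to K$ is continuous. The subgroup $H$ is called relatively amenable (in $G$) if $H$ fixes a point in every non-empty convex compact $G$-space, and a topological group is called amenable if it fixes a point in every non-empty convex compact space on which it acts in this way. Let $\mathrm{Ind}_H^G \mathbf{1}_H$ be the quasi-regular unitary representation of $G$ on $L^2(G/H,\mu)$, where $\mu$ is a non-zero Radon measure on $G/H$ whose translates $E\mapsto\mu(gE)$ have a positive density with respect to $\mu$ that is jointly continuous in $g\in G$ and $x\in G/H$ (such a $\mu$ exists, and the representation is independent of its choice up to unitary equivalence): $$(\pi(g)f)(x)=\Big(\frac{d\mu(g^{-1}x)}{d\mu(x)}\Big)^{1/2} f(g^{-1}x).$$ Suppose that $H$ satisfies Derighetti's condition $\mathbf{1}_H\prec(\mathrm{Ind}_H^G\mathbf{1}_H)|_H$, i.e. the trivial representation of $H$ is weakly contained in the restriction to $H$ of $\mathrm{Ind}_H^G\mathbf{1}_H$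 (where $\pi\prec\sigma$ means that every function of positive type associated to $\pi$ is a limit, uniformly on compact sets, of finite sums of functions of positive type associated to $\sigma$). If $H$ is relatively amenable, then $H$ is amenable. -/

import Mathlib

open MeasureTheory
open scoped NNReal ENNReal

universe u v w

set_option linter.unusedSectionVars false

/-! ### Convex compact spaces and amenability -/

/-- A convex compact `G`-space in the locally convex space `E`: a compact convex subset of `E`
together with a representation of `G` on `E` by continuous affine automorphisms which preserves
the subset and acts (jointly) continuously on it. -/
structure ConvexCompactGSpace (G : Type u) [Group G] [TopologicalSpace G]
    (E : Type v) [AddCommGroup E] [Module ℝ E] [TopologicalSpace E] where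
  /-- the underlying subset of `E` -/
  carrier : Set E
  convex : Convex ℝ carrier
  isCompact : IsCompact carrier
  /-- the affine representation of `G` on `E` -/
  rep : G →* (E ≃ᵃ[ℝ] E)
  continuous_rep : ∀ g : G, Continuous (rep g)
  mapsTo : ∀ g : G, Set.MapsTo (rep g) carrier carrier
  continuousOn : ContinuousOn (fun p : G × E => rep p.1 p.2) (Set.univ ×ˢ carrier)

/-- A topological group is amenable if it fixes a point in every non-empty convex compact
`G`-space (in Hausdorff locally convex real topological vector spaces `E : Type v`). -/
def Amenable (G : Type u) [Group G] [TopologicalSpace G] : Prop :=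
  ∀ (E : Type v) [AddCommGroup E] [Module ℝ E] [TopologicalSpace E] [IsTopologicalAddGroup E]
    [ContinuousSMul ℝ E] [LocallyConvexSpace ℝ E] [T2Space E] (K : ConvexCompactGSpace G E),
    K.carrier.Nonempty → ∃ x ∈ K.carrier, ∀ g : G, K.rep g x = x

/-- A subgroup `H` of `G` is amenable relative to `G` if it fixes a point in every non-empty
convex compact `G`-space. -/
def RelativelyAmenable {G : Type u} [Group G] [TopologicalSpace G] (H : Subgroup G) : Prop :=
  ∀ (E : Type v) [AddCommGroup E] [Module ℝ E] [TopologicalSpace E] [IsTopologicalAddGroup E]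
    [ContinuousSMul ℝ E] [LocallyConvexSpace ℝ E] [T2Space E] (K : ConvexCompactGSpace G E),
    K.carrier.Nonempty → ∃ x ∈ K.carrier, ∀ h ∈ H, K.rep h x = x

/-! ### Weak containment of unitary representations -/

/-- Weak containment `π ≺ σ` of unitary representations of `Γ`: every function of positive type
associated to `π` is, uniformly on compact sets, a limit of finite sums of functions of positive
type associated to `σ`. -/
def WeaklyContained {Γ : Type u} [Group Γ] [TopologicalSpace Γ]
    {V : Type v} [NormedAddCommGroup V] [InnerProductSpace ℂ V]
    {W : Type w} [NormedAddCommGroup W] [InnerProductSpace ℂ W]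
    (π : Γ →* (V ≃ₗᵢ[ℂ] V)) (σ : Γ →* (W ≃ₗᵢ[ℂ] W)) : Prop :=
  ∀ (ξ : V) (Q : Set Γ), IsCompact Q → ∀ ε : ℝ, 0 < ε →
    ∃ (n : ℕ) (η : Fin n → W), ∀ g ∈ Q,
      ‖inner ℂ ξ (π g ξ) - ∑ i, inner ℂ (η i) (σ g (η i))‖ < ε

/-- The one-dimensional trivial unitary representation of `Γ`. -/
noncomputable def trivialRep (Γ : Type u) [Group Γ] : Γ →* (ℂ ≃ₗᵢ[ℂ] ℂ) := 1

/-! ### Strongly quasi-invariant measures and the quasi-regular representation -/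

/-- A strongly `G`-quasi-invariant measure on `X`: a non-zero Radon measure `μ` whose translates
have a continuous, positive density, `d μ(g x) = cocycle g x dμ(x)`. -/
structure StronglyQuasiInvariantMeasure (G : Type u) [Group G] [TopologicalSpace G]
    (X : Type v) [TopologicalSpace X] [MulAction G X] [MeasurableSpace X] where
  /-- the underlying measure -/
  μ : Measure X
  regular : μ.Regular
  ne_zero : μ ≠ 0
  /-- the Radon–Nikodym derivatives -/
  cocycle : G → X → ℝ≥0
  continuous_cocycle : Continuous fun p : G × X => cocycle p.1 p.2
  cocycle_pos : ∀ g x, 0 < cocycle g x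
  map_eq : ∀ g : G,
    μ.map (fun x => g⁻¹ • x) = μ.withDensity (fun x => (cocycle g x : ℝ≥0∞))

namespace StronglyQuasiInvariantMeasure

variable {G : Type u} [Group G] [TopologicalSpace G] {X : Type v} [TopologicalSpace X]
  [MulAction G X] [ContinuousConstSMul G X] [MeasurableSpace X] [BorelSpace X]

theorem continuous_cocycle_right (m : StronglyQuasiInvariantMeasure G X) (g : G) :
    Continuous (m.cocycle g) :=
  m.continuous_cocycle.comp (Continuous.prodMk_right g)

theorem measurable_cocycle (m : StronglyQuasiInvariantMeasure G X) (g : G) :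
    Measurable fun x => (m.cocycle g x : ℝ≥0∞) :=
  (m.continuous_cocycle_right g).measurable.coe_nnreal_ennreal

theorem measurable_smul' (g : G) : Measurable fun x : X => g • x :=
  (continuous_const_smul g).measurable

theorem quasiMeasurePreserving (m : StronglyQuasiInvariantMeasure G X) (g : G) :
    Measure.QuasiMeasurePreserving (fun x : X => g⁻¹ • x) m.μ m.μ :=
  ⟨measurable_smul' _, by rw [m.map_eq]; exact withDensity_absolutelyContinuous _ _⟩

theorem lintegral_cocycle_mul (m : StronglyQuasiInvariantMeasure G X) (g : G) {F : X → ℝ≥0∞}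
    (hF : AEMeasurable F m.μ) :
    ∫⁻ x, m.cocycle g⁻¹ x * F (g⁻¹ • x) ∂m.μ = ∫⁻ x, F x ∂m.μ := by
  have h1 := lintegral_withDensity_eq_lintegral_mul₀ (μ := m.μ)
    (m.measurable_cocycle g⁻¹).aemeasurable
    (hF.comp_quasiMeasurePreserving (m.quasiMeasurePreserving g))
  simp only [Pi.mul_apply, Function.comp_apply] at h1
  rw [← h1, ← m.map_eq g⁻¹]
  have h2 := m.quasiMeasurePreserving g⁻¹
  rw [lintegral_map']
  · simp
  · refine AEMeasurable.mono_ac ?_ h2.absolutelyContinuous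
    exact hF.comp_quasiMeasurePreserving (m.quasiMeasurePreserving g)
  · exact (measurable_smul' _).aemeasurable

theorem null_of_withDensity_eq {μ : Measure X} [μ.Regular] {a b : X → ℝ≥0}
    (ha : Continuous a) (hb : Continuous b)
    (hab : μ.withDensity (fun x => (a x : ℝ≥0∞)) = μ.withDensity (fun x => (b x : ℝ≥0∞))) :
    μ {x | a x < b x} = 0 := by
  have hU : IsOpen {x | a x < b x} := isOpen_lt ha hb
  rw [hU.measure_eq_iSup_isCompact]
  simp only [ENNReal.iSup_eq_zero]
  intro K hKU hK
  obtain ⟨c, hc⟩ := (hK.image ha).bddAbove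
  have hc' : ∀ x ∈ K, a x ≤ c := fun x hx => hc ⟨x, hx, rfl⟩
  let M : Set X := toMeasurable μ K ∩ ({x | a x < b x} ∩ {x | a x < c + 1})
  have hMm : MeasurableSet M := (measurableSet_toMeasurable _ _).inter
    (hU.measurableSet.inter (isOpen_lt ha continuous_const).measurableSet)
  have hKM : K ⊆ M := fun x hx =>
    ⟨subset_toMeasurable _ _ hx, hKU hx, lt_of_le_of_lt (hc' x hx) (by simp)⟩
  have hMfin : μ M < ∞ := lt_of_le_of_lt (measure_mono Set.inter_subset_left)
    (by rw [measure_toMeasurable]; exact hK.measure_lt_top)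
  have hint : ∫⁻ x in M, (a x : ℝ≥0∞) ∂μ = ∫⁻ x in M, (b x : ℝ≥0∞) ∂μ := by
    rw [← withDensity_apply _ hMm, ← withDensity_apply _ hMm, hab]
  have hfin : ∫⁻ x in M, (a x : ℝ≥0∞) ∂μ ≠ ∞ := by
    refine ne_of_lt (lt_of_le_of_lt (setLIntegral_mono (g := fun _ => ((c + 1 : ℝ≥0) : ℝ≥0∞))
      measurable_const (fun x hx => ?_)) ?_)
    · exact_mod_cast hx.2.2.le
    · rw [setLIntegral_const]; exact ENNReal.mul_lt_top ENNReal.coe_lt_top hMfin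
  by_contra hne
  have hM0 : μ M ≠ 0 := fun h => hne (measure_mono_null hKM h)
  have := setLIntegral_strict_mono (μ := μ) hMm hM0 (f := fun x => (a x : ℝ≥0∞))
    (g := fun x => (b x : ℝ≥0∞)) hb.measurable.coe_nnreal_ennreal hfin
    (Filter.Eventually.of_forall fun x hx => by exact_mod_cast hx.2.1)
  exact absurd hint this.ne

theorem ae_eq_of_withDensity_eq {μ : Measure X} [μ.Regular] {a b : X → ℝ≥0}
    (ha : Continuous a) (hb : Continuous b)
    (hab : μ.withDensity (fun x => (a x : ℝ≥0∞)) = μ.withDensity (fun x => (b x : ℝ≥0∞))) :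
    a =ᵐ[μ] b := by
  have h1 := null_of_withDensity_eq ha hb hab
  have h2 := null_of_withDensity_eq hb ha hab.symm
  have h3 := measure_union_null h1 h2
  refine measure_mono_null (fun x hx => ?_) h3
  exact lt_or_gt_of_ne hx

/-- The cocycle identity, almost everywhere. -/
theorem cocycle_mul (m : StronglyQuasiInvariantMeasure G X) (g h : G) :
    m.cocycle (g * h) =ᵐ[m.μ] fun x => m.cocycle g (h • x) * m.cocycle h x := by
  have := m.regular
  refine ae_eq_of_withDensity_eq (m.continuous_cocycle_right _)
    (((m.continuous_cocycle_right g).comp (continuous_const_smul h)).mul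
      (m.continuous_cocycle_right h)) ?_
  rw [← m.map_eq (g * h)]
  have hcomp : (fun x : X => (g * h)⁻¹ • x) = (fun x => h⁻¹ • x) ∘ (fun x => g⁻¹ • x) := by
    funext x; simp [mul_smul]
  rw [hcomp, ← Measure.map_map (measurable_smul' _) (measurable_smul' _), m.map_eq g]
  ext s hs
  rw [Measure.map_apply (measurable_smul' _) hs,
    withDensity_apply _ (measurable_smul' _ hs), withDensity_apply _ hs,
    ← lintegral_indicator (measurable_smul' _ hs), ← lintegral_indicator hs]
  have h1 := m.lintegral_cocycle_mul h⁻¹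
    (F := ((fun x => h⁻¹ • x) ⁻¹' s).indicator fun x => (m.cocycle g x : ℝ≥0∞))
    ((m.measurable_cocycle g).indicator (measurable_smul' _ hs)).aemeasurable
  rw [← h1]
  refine lintegral_congr fun x => ?_
  by_cases hx : x ∈ s <;> simp [Set.indicator, hx, mul_comm]

theorem cocycle_one (m : StronglyQuasiInvariantMeasure G X) :
    m.cocycle 1 =ᵐ[m.μ] fun _ => 1 := by
  have := m.regular
  refine ae_eq_of_withDensity_eq (m.continuous_cocycle_right _) continuous_const ?_
  rw [← m.map_eq 1]
  simp

/-- The formula `(π(g) f)(x) = (d μ(g⁻¹ x) / dμ(x)) ^ (1/2) f(g⁻¹ x)` of the quasi-regular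
representation. -/
noncomputable def translate (m : StronglyQuasiInvariantMeasure G X) (g : G) (f : X → ℂ) :
    X → ℂ :=
  fun x => (Real.sqrt (m.cocycle g⁻¹ x) : ℂ) * f (g⁻¹ • x)

theorem translate_congr (m : StronglyQuasiInvariantMeasure G X) (g : G) {f f' : X → ℂ}
    (h : f =ᵐ[m.μ] f') : m.translate g f =ᵐ[m.μ] m.translate g f' := by
  have h1 := (m.quasiMeasurePreserving g).ae_eq_comp h
  filter_upwards [h1] with x hx
  simp only [Function.comp_apply] at hx
  simp [translate, hx]

theorem aestronglyMeasurable_translate (m : StronglyQuasiInvariantMeasure G X) (g : G)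
    {f : X → ℂ} (hf : AEStronglyMeasurable f m.μ) :
    AEStronglyMeasurable (m.translate g f) m.μ := by
  have h1 : Measurable fun x => (Real.sqrt (m.cocycle g⁻¹ x) : ℂ) := by
    have := (m.continuous_cocycle_right g⁻¹).measurable
    fun_prop
  exact h1.aestronglyMeasurable.mul (hf.comp_quasiMeasurePreserving (m.quasiMeasurePreserving g))

theorem eLpNorm_translate (m : StronglyQuasiInvariantMeasure G X) (g : G)
    {f : X → ℂ} (hf : AEStronglyMeasurable f m.μ) :
    eLpNorm (m.translate g f) 2 m.μ = eLpNorm f 2 m.μ := by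
  rw [eLpNorm_eq_lintegral_rpow_enorm_toReal (by simp) (by simp),
    eLpNorm_eq_lintegral_rpow_enorm_toReal (by simp) (by simp)]
  congr 1
  rw [← m.lintegral_cocycle_mul g (F := fun x => ‖f x‖ₑ ^ (2 : ℝ≥0∞).toReal)
    (hf.enorm.pow_const _)]
  refine lintegral_congr fun x => ?_
  simp only [translate, ENNReal.toReal_ofNat, ENNReal.rpow_ofNat, enorm_mul, mul_pow]
  congr 1
  have h0 : ‖(Real.sqrt (m.cocycle g⁻¹ x) : ℂ)‖₊ ^ 2 = m.cocycle g⁻¹ x := by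
    apply NNReal.eq
    simp
  rw [enorm_eq_nnnorm]
  exact_mod_cast h0

theorem translate_mul (m : StronglyQuasiInvariantMeasure G X) (g h : G) (f : X → ℂ) :
    m.translate (g * h) f =ᵐ[m.μ] m.translate g (m.translate h f) := by
  filter_upwards [m.cocycle_mul h⁻¹ g⁻¹] with x hx
  simp only [translate, mul_inv_rev, hx, NNReal.coe_mul, mul_smul]
  rw [Real.sqrt_mul (NNReal.coe_nonneg _)]
  push_cast
  ring

theorem translate_one (m : StronglyQuasiInvariantMeasure G X) (f : X → ℂ) :
    m.translate 1 f =ᵐ[m.μ] f := by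
  filter_upwards [m.cocycle_one] with x hx
  simp [translate, hx]

theorem memLp_translate (m : StronglyQuasiInvariantMeasure G X) (g : G) (f : Lp ℂ 2 m.μ) :
    MemLp (m.translate g f) 2 m.μ :=
  ⟨m.aestronglyMeasurable_translate g (Lp.aestronglyMeasurable f), by
    rw [m.eLpNorm_translate g (Lp.aestronglyMeasurable f)]; exact Lp.eLpNorm_lt_top f⟩

/-- The quasi-regular representation as a linear isometry of `L²(X, μ)`. -/
noncomputable def translateLp (m : StronglyQuasiInvariantMeasure G X) (g : G) :
    Lp ℂ 2 m.μ →ₗᵢ[ℂ] Lp ℂ 2 m.μ where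
  toFun f := (m.memLp_translate g f).toLp
  map_add' f f' := by
    rw [← MemLp.toLp_add (m.memLp_translate g f) (m.memLp_translate g f')]
    refine MemLp.toLp_congr _ _ ((m.translate_congr g (Lp.coeFn_add f f')).trans ?_)
    exact Filter.Eventually.of_forall fun x => by simp [translate, mul_add]
  map_smul' c f := by
    rw [RingHom.id_apply, ← MemLp.toLp_const_smul c (m.memLp_translate g f)]
    refine MemLp.toLp_congr _ _ ((m.translate_congr g (Lp.coeFn_smul c f)).trans ?_)
    exact Filter.Eventually.of_forall fun x => by simp [translate, mul_left_comm]
  norm_map' f := by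
    change ‖(m.memLp_translate g f).toLp‖ = ‖f‖
    rw [Lp.norm_toLp, m.eLpNorm_translate g (Lp.aestronglyMeasurable f), Lp.norm_def]

theorem coeFn_translateLp (m : StronglyQuasiInvariantMeasure G X) (g : G) (f : Lp ℂ 2 m.μ) :
    m.translateLp g f =ᵐ[m.μ] m.translate g f :=
  MemLp.coeFn_toLp (m.memLp_translate g f)

theorem translateLp_mul (m : StronglyQuasiInvariantMeasure G X) (g h : G) (f : Lp ℂ 2 m.μ) :
    m.translateLp (g * h) f = m.translateLp g (m.translateLp h f) := by
  refine Lp.ext ?_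
  refine (m.coeFn_translateLp _ _).trans ((m.translate_mul g h f).trans ?_)
  exact ((m.coeFn_translateLp g _).trans (m.translate_congr g (m.coeFn_translateLp h f))).symm

theorem translateLp_one (m : StronglyQuasiInvariantMeasure G X) (f : Lp ℂ 2 m.μ) :
    m.translateLp 1 f = f :=
  Lp.ext ((m.coeFn_translateLp _ _).trans (m.translate_one f))

/-- The (unitary) quasi-regular representation of `G` on `L²(X, μ)`,
`(π(g) f)(x) = (d μ(g⁻¹ x) / dμ(x)) ^ (1/2) f(g⁻¹ x)`. -/
noncomputable def quasiRegular (m : StronglyQuasiInvariantMeasure G X) :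
    G →* (Lp ℂ 2 m.μ ≃ₗᵢ[ℂ] Lp ℂ 2 m.μ) where
  toFun g :=
    { toLinearEquiv := LinearEquiv.ofLinearMap (m.translateLp g).toLinearMap
        (m.translateLp g⁻¹).toLinearMap
        (by ext1 f; simp [← translateLp_mul, translateLp_one])
        (by ext1 f; simp [← translateLp_mul, translateLp_one])
      norm_map' := (m.translateLp g).norm_map }
  map_one' := by
    ext1 f
    exact m.translateLp_one f
  map_mul' g h := by
    ext1 f
    exact m.translateLp_mul g h f

end StronglyQuasiInvariantMeasure

/-- Derighetti's condition: the trivial representation of `H` is weakly contained in the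
restriction to `H` of the quasi-regular representation `Ind_H^G 1_H` of `G` on `L²(G/H, μ)`.
Here `G/H` carries its Borel σ-algebra and `μ` is a strongly `G`-quasi-invariant measure; up to
unitary equivalence the representation does not depend on the choice of `μ`. -/
def DerighettiCondition {G : Type u} [Group G] [TopologicalSpace G] [IsTopologicalGroup G]
    (H : Subgroup G) : Prop :=
  letI : MeasurableSpace (G ⧸ H) := borel (G ⧸ H)
  haveI : BorelSpace (G ⧸ H) := ⟨rfl⟩
  ∃ m : StronglyQuasiInvariantMeasure G (G ⧸ H),
    WeaklyContained (trivialRep H) (m.quasiRegular.comp H.subtype)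

/-! Consider the essentially bounded maps Φ from G to the means on `H →ᵇ ℝ` with Φ(hx) = hΦ(x) for h
in H. They form a convex compact space on which G acts by right translation, (gΦ)(x) = Φ(xg).
Relative amenability gives a Φ fixed by H, that is, an H-equivariant map from G/H to the means on H.
Derighetti's condition gives finite families of vectors in L²(G/H) that are almost H-invariant. The
sums of their squared moduli are almost H-invariant densities f on G/H, so that ∫ f(q) Φ(q) dμ(q) is
an almost H-invariant mean on H. Barycentres of an orbit map under such means are almost fixed
points, and compactness yields a fixed point (`amenable_of_approximately_invariant_means`).

To avoid measurable maps into a dual space, Φ is encoded by the bilinear form T(F, φ) = ∫ F(x)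
Φ(x)(φ) dν(x) on `C_c(G, ℝ)` × (`H →ᵇ ℝ`), with ν a Haar measure of G. The bound |T(F, φ)| ≤ ‖φ‖
‖F‖₁ makes compactness a case of Tychonoff's theorem and also gives joint continuity of the action.

In exchange, the passage from G to G/H must be made for T itself. Weil's formula writes μ in terms
of ν and a density ρ with ρ = Δ_G/Δ_H on H. The key estimate `abs_apply_mulRho_le` says that for
H-invariant T and φ ≥ 0 the number T(ρB, φ) is controlled by the L¹(μ)-norm of the fibre integral of
B. It comes from the Riesz measure of the positive functional B ↦ T(ρB, φ), for which fibre
integration is symmetric. Hence T pairs with densities on G/H, and almost invariance of f passes to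
the mean. -/

open scoped BoundedContinuousFunction Pointwise

/-! ### Barycentres and a criterion for amenability -/

section Barycenter

variable {Γ : Type u} [TopologicalSpace Γ]
  {E : Type v} [AddCommGroup E] [Module ℝ E] [TopologicalSpace E]

/-- The bounded continuous function `a ∘ o`, for a continuous map `o` into a compact set and a
continuous linear functional `a`. -/
theorem exists_boundedContinuous_comp {K : Set E} (hK : IsCompact K) {o : Γ → E}
    (ho : Continuous o) (hoK : ∀ γ, o γ ∈ K) (a : E →L[ℝ] ℝ) :
    ∃ φ : Γ →ᵇ ℝ, ∀ γ, φ γ = a (o γ) := by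
  obtain ⟨C, hC⟩ := hK.exists_bound_of_continuousOn a.continuous.continuousOn
  exact ⟨BoundedContinuousFunction.ofNormedAddCommGroup (fun γ => a (o γ))
    (a.continuous.comp ho) C fun γ => hC _ (hoK γ), fun γ => rfl⟩

theorem mean_le {m : (Γ →ᵇ ℝ) →ₗ[ℝ] ℝ} (hm : ∀ φ, 0 ≤ φ → 0 ≤ m φ) (h1 : m 1 = 1)
    {φ : Γ →ᵇ ℝ} {s : ℝ} (h : ∀ γ, φ γ ≤ s) : m φ ≤ s := by
  have h2 := hm (s • 1 - φ) fun γ => by simpa using h γ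
  simpa [h1] using h2

/-- A mean on the bounded continuous functions, pushed forward to a compact convex set, has a
barycentre. -/
theorem exists_barycenter {m : (Γ →ᵇ ℝ) →ₗ[ℝ] ℝ} (hm : ∀ φ, 0 ≤ φ → 0 ≤ m φ) (h1 : m 1 = 1)
    {K : Set E} (hc : Convex ℝ K) (hK : IsCompact K) {o : Γ → E}
    (ho : Continuous o) (hoK : ∀ γ, o γ ∈ K) :
    ∃ x ∈ K, ∀ (a : E →L[ℝ] ℝ) (φ : Γ →ᵇ ℝ), (∀ γ, φ γ = a (o γ)) → a x = m φ := by
  choose Φ hΦ using exists_boundedContinuous_comp hK ho hoK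
  suffices h : (K ∩ ⋂ a : E →L[ℝ] ℝ, {x | a x = m (Φ a)}).Nonempty by
    obtain ⟨x, hxK, hx⟩ := h
    refine ⟨x, hxK, fun a φ hφ => ?_⟩
    have h2 : φ = Φ a := by ext γ; rw [hφ, hΦ]
    rw [h2]
    exact Set.mem_iInter.1 hx a
  -- Each condition is closed, so compactness of `K` leaves finitely many functionals to satisfy.
  refine hK.inter_iInter_nonempty _ (fun a => isClosed_eq a.continuous continuous_const)
    fun S => ?_
  let A : E →ₗ[ℝ] (S → ℝ) := LinearMap.pi fun a => (a : E →L[ℝ] ℝ).toLinearMap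
  have hA : Continuous A := continuous_pi fun a => (a : E →L[ℝ] ℝ).continuous
  by_contra hempty
  have hnot : (fun a : S => m (Φ a)) ∉ A '' K := by
    rintro ⟨x, hx, hAx⟩
    refine hempty ⟨x, hx, ?_⟩
    simp only [Set.mem_iInter]
    intro a ha
    exact congrFun hAx ⟨a, ha⟩
  -- A separating linear form would give a bounded function that is at most `s` everywhere but has
  -- mean larger than `s`.
  obtain ⟨f, s, hf1, hf2⟩ := geometric_hahn_banach_closed_point (hc.linear_image A)
    (hK.image hA).isClosed hnot
  classical
  have hf : ∀ y : S → ℝ, f y = ∑ a, y a * f (Pi.single a 1) := by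
    intro y
    have := f.toLinearMap.pi_apply_eq_sum_univ y
    simp only [smul_eq_mul] at this
    rw [show f y = (f : (S → ℝ) →ₗ[ℝ] ℝ) y from rfl, this]
    refine Finset.sum_congr rfl fun a _ => congrArg (fun z => y a * f z) (funext fun b => ?_)
    simp [Pi.single_apply, eq_comm]
  have hle : m (∑ a : S, f (Pi.single a 1) • Φ a) ≤ s := by
    refine mean_le hm h1 fun γ => ?_
    have := (hf1 (A (o γ)) ⟨_, hoK γ, rfl⟩).le
    rw [hf] at this
    simpa [hΦ, A, mul_comm, BoundedContinuousFunction.sum_apply] using this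
  rw [hf] at hf2
  simp only [map_sum, map_smul, smul_eq_mul] at hle
  simp only [mul_comm (m _)] at hf2
  linarith

end Barycenter

/-- A topological group is amenable if its bounded continuous functions have approximately
invariant means. -/
theorem amenable_of_approximately_invariant_means {Γ : Type u} [Group Γ] [TopologicalSpace Γ]
    [IsTopologicalGroup Γ]
    (hΓ : ∀ (Q : Finset Γ) (ε : ℝ), 0 < ε → ∃ m : (Γ →ᵇ ℝ) →ₗ[ℝ] ℝ, (∀ φ, 0 ≤ φ → 0 ≤ m φ) ∧
      m 1 = 1 ∧ ∀ h ∈ Q, ∀ φ ψ : Γ →ᵇ ℝ, (∀ x, ψ x = φ (h * x)) → |m ψ - m φ| ≤ ε * ‖φ‖) :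
    Amenable.{u, v} Γ := by
  intro E _ _ _ _ _ _ _ K hne
  obtain ⟨x₀, hx₀⟩ := hne
  have ho : Continuous fun γ => K.rep γ x₀ :=
    K.continuousOn.comp_continuous (f := fun γ : Γ => (γ, x₀)) (by fun_prop)
      (fun γ => ⟨Set.mem_univ _, hx₀⟩)
  have hoK : ∀ γ, K.rep γ x₀ ∈ K.carrier := fun γ => K.mapsTo γ hx₀
  -- Almost fixed points: the displacement is tested by all functionals at once, each scaled by a
  -- bound `C` on `K`. This makes the sets closed and directed.
  let Z : Finset Γ × ℕ → Set E := fun i => K.carrier ∩ {x | ∀ h ∈ i.1, ∀ (a : E →L[ℝ] ℝ) (C : ℝ),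
    (∀ y ∈ K.carrier, |a y| ≤ C) → |a (K.rep h x) - a x| ≤ 1 / ((i.2 : ℝ) + 1) * C}
  have hZclosed : ∀ i, IsClosed (Z i) := by
    intro i
    refine K.isCompact.isClosed.inter ?_
    simp only [Set.ofPred_forall]
    refine isClosed_iInter fun h => isClosed_iInter fun _ => isClosed_iInter fun a =>
      isClosed_iInter fun C => isClosed_iInter fun _ => ?_
    exact isClosed_le ((((a.continuous.comp (K.continuous_rep h)).sub a.continuous)).abs)
      continuous_const
  have hZne : ∀ i, (Z i).Nonempty := by
    rintro ⟨Q, n⟩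
    obtain ⟨m, hm, h1, hinv⟩ := hΓ Q (1 / ((n : ℝ) + 1)) (by positivity)
    obtain ⟨x, hxK, hx⟩ := exists_barycenter hm h1 K.convex K.isCompact ho hoK
    refine ⟨x, hxK, fun h hh a C hC => ?_⟩
    have hlin : Continuous (K.rep h).linear := by
      have : ((K.rep h).linear : E → E) = fun y => K.rep h y - K.rep h 0 := by
        funext y
        have := (K.rep h).map_vadd 0 y
        simp at this
        simp [this]
      rw [show ((K.rep h).linear : E → E) = _ from this]
      exact (K.continuous_rep h).sub continuous_const
    -- Barycentres are tested on linear functionals only, so `a ∘ rep h` is split into a linear part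
    -- and a constant; the normalization `m 1 = 1` accounts for the constant.
    let b : E →L[ℝ] ℝ := a.comp ⟨(K.rep h).linear.toLinearMap, hlin⟩
    have hb : ∀ y, a (K.rep h y) = b y + a (K.rep h 0) := by
      intro y
      have := (K.rep h).map_vadd 0 y
      simp at this
      simp [this, b]
    obtain ⟨φ, hφ⟩ := exists_boundedContinuous_comp K.isCompact ho hoK a
    obtain ⟨θ, hθ⟩ := exists_boundedContinuous_comp K.isCompact ho hoK b
    let ψ : Γ →ᵇ ℝ := θ + a (K.rep h 0) • 1
    have hψ : ∀ γ, ψ γ = φ (h * γ) := by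
      intro γ
      simp [ψ, hθ, hφ, ← hb]
    have h3 : a (K.rep h x) = m ψ := by
      rw [hb, hx b θ hθ]; simp [ψ, h1]
    rw [h3, hx a φ hφ]
    refine (hinv h hh φ ψ hψ).trans ?_
    gcongr
    have hC0 : 0 ≤ C := (abs_nonneg _).trans (hC x₀ hx₀)
    exact (BoundedContinuousFunction.norm_le hC0).2 fun γ => by rw [hφ]; exact hC _ (hoK γ)
  have hdir : Directed (· ⊇ ·) Z := by
    classical
    rintro ⟨Q, n⟩ ⟨Q', n'⟩
    refine ⟨(Q ∪ Q', max n n'), ?_, ?_⟩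
    all_goals
      rintro x ⟨hxK, hx⟩
      refine ⟨hxK, fun h hh a C hC => (hx h (by simp at hh ⊢; tauto) a C hC).trans ?_⟩
      have hC0 : 0 ≤ C := (abs_nonneg _).trans (hC x₀ hx₀)
      gcongr
      simp
  obtain ⟨x, hx⟩ := IsCompact.nonempty_iInter_of_directed_nonempty_isCompact_isClosed Z hdir hZne
    (fun i => K.isCompact.of_isClosed_subset (hZclosed i) Set.inter_subset_left) hZclosed
  rw [Set.mem_iInter] at hx
  refine ⟨x, (hx (∅, 0)).1, fun g => ?_⟩
  by_contra hne
  obtain ⟨a, ha⟩ := geometric_hahn_banach_point_point hne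
  refine absurd ?_ ha.ne
  obtain ⟨C, hC⟩ := K.isCompact.exists_bound_of_continuousOn a.continuous.continuousOn
  have hlim : Filter.Tendsto (fun n : ℕ => 1 / ((n : ℝ) + 1) * C) Filter.atTop (nhds (0 * C)) :=
    tendsto_one_div_add_atTop_nhds_zero_nat.mul_const C
  have h0 := ge_of_tendsto' hlim fun n => (hx ({g}, n)).2 g (by simp) a C hC
  rw [zero_mul] at h0
  exact sub_eq_zero.1 (abs_nonpos_iff.1 h0)

/-! ### Haar measures and the modular function -/

section Modular

open Measure

variable {Γ : Type u} [Group Γ] [TopologicalSpace Γ] [IsTopologicalGroup Γ]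

theorem hasCompactSupport_mul_right {F : Γ → ℝ} (hFc : HasCompactSupport F) (g : Γ) :
    HasCompactSupport fun x => F (x * g) :=
  hFc.comp_homeomorph (Homeomorph.mulRight g)

theorem hasCompactSupport_mul_left {F : Γ → ℝ} (hFc : HasCompactSupport F) (g : Γ) :
    HasCompactSupport fun x => F (g * x) :=
  hFc.comp_homeomorph (Homeomorph.mulLeft g)

variable [LocallyCompactSpace Γ] [MeasurableSpace Γ] [BorelSpace Γ]

/-- A right translate of a Haar measure is again left invariant, hence proportional to it on
compactly supported functions. This fixes the convention for the modular function used throughout.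
-/
theorem integral_mul_right_eq_modularCharacterFun (μ : Measure Γ) [IsHaarMeasure μ] {F : Γ → ℝ}
    (hF : Continuous F) (hFc : HasCompactSupport F) (g : Γ) :
    ∫ x, F (x * g) ∂μ = modularCharacterFun g * ∫ x, F x ∂μ := by
  have h := integral_isMulLeftInvariant_eq_smul_of_hasCompactSupport (μ.map (· * g)) μ hF hFc
  rw [integral_map (by fun_prop) hF.aestronglyMeasurable, integral_smul_nnreal_measure,
    ← modularCharacterFun_eq_haarScalarFactor] at h
  exact h

/-- Right translation is continuous in `L¹`-norm on compactly supported continuous functions. -/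
theorem continuous_integral_dist_mul_right (μ : Measure Γ) [IsFiniteMeasureOnCompacts μ]
    {F : Γ → ℝ} (hF : Continuous F) (hFc : HasCompactSupport F) {N : ℝ → ℝ → ℝ}
    (hN : Continuous N.uncurry) (hN0 : N 0 0 = 0) (g₀ : Γ) :
    Continuous fun g => ∫ x, N (F (x * g)) (F (x * g₀)) ∂μ := by
  refine continuous_iff_continuousAt.2 fun g₁ => ?_
  obtain ⟨U, hU, hUn⟩ := exists_compact_mem_nhds g₁
  -- For `g` in the compact neighbourhood `U`, all integrands are supported in this one compact set.
  have hk : IsCompact (tsupport F * (insert g₀ U)⁻¹) :=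
    IsCompact.mul hFc (hU.insert g₀).inv
  refine (continuousOn_integral_of_compact_support (μ := μ) (s := U) hk
    (f := fun g x => N (F (x * g)) (F (x * g₀))) ?_ ?_).continuousAt hUn
  · refine Continuous.continuousOn ?_
    exact hN.comp ((hF.comp (by fun_prop : Continuous fun p : Γ × Γ => p.2 * p.1)).prodMk
      (hF.comp (by fun_prop : Continuous fun p : Γ × Γ => p.2 * g₀)))
  · intro g x hg hx
    have key : ∀ g ∈ insert g₀ U, F (x * g) = 0 := by
      intro g hg
      by_contra h
      exact hx ⟨x * g, subset_tsupport _ h, g⁻¹, Set.inv_mem_inv.2 hg, by simp⟩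
    simp only [key g (Set.mem_insert_of_mem _ hg), key g₀ (Set.mem_insert _ _), hN0]

/-- The modular function is the ratio of ∫ F(xg) dx to ∫ F(x) dx for a fixed bump function F, and
the numerator is continuous in g. -/
theorem continuous_modularCharacterFun [T2Space Γ] :
    Continuous fun g : Γ => (modularCharacterFun g : ℝ) := by
  obtain ⟨⟨F, hF⟩, hFc, hF0, hF1⟩ :
    ∃ f : C(Γ, ℝ), HasCompactSupport f ∧ 0 ≤ f ∧ f 1 ≠ 0 := exists_continuous_nonneg_pos 1
  have hpos : 0 < ∫ x, F x ∂(haar : Measure Γ) :=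
    hF.integral_pos_of_hasCompactSupport_nonneg_nonzero hFc hF0 hF1
  have h1 := (continuous_integral_dist_mul_right (haar : Measure Γ) hF hFc
    (N := fun a _ => a) continuous_fst rfl 1).div_const (∫ x, F x ∂(haar : Measure Γ))
  refine h1.congr fun g => ?_
  rw [integral_mul_right_eq_modularCharacterFun _ hF hFc, mul_div_cancel_right₀ _ hpos.ne']

/-- Inversion of the Haar measure. -/
theorem integral_inv_mul_modularCharacterFun [T2Space Γ] (μ : Measure Γ) [IsHaarMeasure μ]
    {F : Γ → ℝ} (hF : Continuous F) (hFc : HasCompactSupport F) :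
    ∫ x, modularCharacterFun x * F x⁻¹ ∂μ = ∫ x, F x ∂μ := by
  obtain ⟨⟨P, hP⟩, hPc, hP0, hP1⟩ :
    ∃ f : C(Γ, ℝ), HasCompactSupport f ∧ 0 ≤ f ∧ f 1 ≠ 0 := exists_continuous_nonneg_pos 1
  have hpos : 0 < ∫ x, P x ∂μ :=
    hP.integral_pos_of_hasCompactSupport_nonneg_nonzero hPc hP0 hP1
  simp only [ContinuousMap.coe_mk] at hP1 hPc
  refine mul_right_cancel₀ hpos.ne' ?_
  -- The auxiliary factor ∫ P absorbs the modular function as a right translation; two applications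
  -- of Fubini and left invariance then do the rest.
  calc (∫ k, modularCharacterFun k * F k⁻¹ ∂μ) * ∫ x, P x ∂μ
      = ∫ k, ∫ x, F k⁻¹ * P (x * k) ∂μ ∂μ := by
        rw [← integral_mul_const]
        refine integral_congr_ae (.of_forall fun k => ?_)
        simp only [integral_const_mul, integral_mul_right_eq_modularCharacterFun μ hP hPc]
        ring
    _ = ∫ x, ∫ k, F k⁻¹ * P (x * k) ∂μ ∂μ := by
        refine integral_integral_swap_of_hasCompactSupport (by fun_prop) ?_
        refine HasCompactSupport.intro
          ((IsCompact.inv hFc).prod (IsCompact.mul hPc (IsCompact.inv (IsCompact.inv hFc)))) ?_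
        rintro ⟨k, x⟩ hkx
        by_contra hne
        simp only [Function.uncurry, mul_eq_zero, not_or] at hne
        refine hkx ⟨subset_tsupport _ hne.1, ?_⟩
        exact ⟨x * k, subset_tsupport _ hne.2, k⁻¹, by simpa using subset_tsupport _ hne.1, by simp⟩
    _ = ∫ x, ∫ k, F (k⁻¹ * x) * P k ∂μ ∂μ := by
        refine integral_congr_ae (.of_forall fun x => ?_)
        simp only
        rw [← integral_mul_left_eq_self (fun k => F k⁻¹ * P (x * k)) x⁻¹]
        simp
    _ = ∫ k, ∫ x, F (k⁻¹ * x) * P k ∂μ ∂μ := by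
        refine integral_integral_swap_of_hasCompactSupport (by fun_prop) ?_
        refine HasCompactSupport.intro (IsCompact.prod (IsCompact.mul hPc hFc) hPc) ?_
        rintro ⟨x, k⟩ hkx
        by_contra hne
        simp only [Function.uncurry, mul_eq_zero, not_or] at hne
        refine hkx ⟨?_, subset_tsupport _ hne.2⟩
        exact ⟨k, subset_tsupport _ hne.2, k⁻¹ * x, subset_tsupport _ hne.1, by simp⟩
    _ = _ := by
        rw [← integral_const_mul]
        refine integral_congr_ae (.of_forall fun k => ?_)
        simp only
        rw [integral_mul_const, integral_mul_left_eq_self (fun x => F x)]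

end Modular

/-! ### Integration along the fibres of `G → G ⧸ H` -/

section Fiber

open Measure

variable {G : Type u} [Group G] [TopologicalSpace G] [IsTopologicalGroup G]
  [MeasurableSpace G] [BorelSpace G] {H : Subgroup G}

/-- The integral of `F` along the coset `x H`. -/
noncomputable def fiberIntegral (η : Measure H) (F : G → ℝ) (x : G) : ℝ :=
  ∫ k : H, F (x * k) ∂η

theorem fiberIntegral_nonneg (η : Measure H) {F : G → ℝ} (hF : 0 ≤ F) (x : G) :
    0 ≤ fiberIntegral η F x :=
  integral_nonneg fun _ => hF _

theorem fiberIntegral_mul_right (η : Measure H) [IsHaarMeasure η] (F : G → ℝ) (x : G) (k : H) :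
    fiberIntegral η F (x * k) = fiberIntegral η F x := by
  have := integral_mul_left_eq_self (μ := η) (fun l : H => F (x * l)) k
  simpa [fiberIntegral, mul_assoc] using this

theorem fiberIntegral_congr (η : Measure H) [IsHaarMeasure η] (F : G → ℝ) {x y : G}
    (hxy : (x : G ⧸ H) = y) : fiberIntegral η F x = fiberIntegral η F y := by
  have := fiberIntegral_mul_right η F x ⟨x⁻¹ * y, QuotientGroup.eq.1 hxy⟩
  simpa using this.symm

/-- A function which is constant along the fibres can be moved out of the fibre integral. -/
theorem fiberIntegral_mul_comp_mk (η : Measure H) (F : G → ℝ) (f : G ⧸ H → ℝ) (x : G) :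
    fiberIntegral η (fun y => F y * f y) x = fiberIntegral η F x * f x := by
  simp only [fiberIntegral, QuotientGroup.mk_mul_of_mem x (SetLike.coe_mem _)]
  rw [integral_mul_const]

theorem exists_of_fiberIntegral_ne_zero {η : Measure H} {F : G → ℝ} {x : G}
    (h : fiberIntegral η F x ≠ 0) : ∃ y : G, (y : G ⧸ H) = x ∧ F y ≠ 0 := by
  by_contra! hcon
  refine h ?_
  simp [fiberIntegral, fun k : H => hcon (x * (k : G)) (QuotientGroup.mk_mul_of_mem x k.2)]

/-- The fibre integral as a function on `G ⧸ H`. -/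
noncomputable def quotientIntegral (η : Measure H) (F : G → ℝ) (q : G ⧸ H) : ℝ :=
  fiberIntegral η F q.out

/-- The chosen representative is irrelevant because η is left invariant. -/
theorem quotientIntegral_mk (η : Measure H) [IsHaarMeasure η] (F : G → ℝ) (x : G) :
    quotientIntegral η F (x : G ⧸ H) = fiberIntegral η F x :=
  fiberIntegral_congr η F (QuotientGroup.out_eq' _)

theorem hasCompactSupport_fiber (hH : IsClosed (H : Set G)) {F : G → ℝ}
    (hFc : HasCompactSupport F) (x : G) : HasCompactSupport fun k : H => F (x * k) :=
  (hasCompactSupport_mul_left hFc x).comp_isClosedEmbedding hH.isClosedEmbedding_subtypeVal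

theorem isCompact_subgroup_preimage (hH : IsClosed (H : Set G)) {K : Set G} (hK : IsCompact K) :
    IsCompact {k : H | (k : G) ∈ K} :=
  hH.isClosedEmbedding_subtypeVal.isCompact_preimage hK

/-- The quotient map is open, so the Hausdorff property amounts to closedness of the relation x⁻¹y ∈
H. -/
theorem t2Space_quotient (hH : IsClosed (H : Set G)) : T2Space (G ⧸ H) := by
  rw [t2Space_iff_of_isOpenQuotientMap QuotientGroup.isOpenQuotientMap_mk]
  simp only [QuotientGroup.eq]
  exact hH.preimage (by fun_prop : Continuous fun q : G × G => q.1⁻¹ * q.2)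

variable [LocallyCompactSpace G] [T2Space G]

theorem continuous_fiberIntegral (hH : IsClosed (H : Set G)) (η : Measure H)
    [IsHaarMeasure η] {F : G → ℝ} (hF : Continuous F) (hFc : HasCompactSupport F) :
    Continuous (fiberIntegral η F) := by
  refine continuous_iff_continuousAt.2 fun x₀ => ?_
  obtain ⟨U, hU, hUn⟩ := exists_compact_mem_nhds x₀
  have hk := isCompact_subgroup_preimage hH (IsCompact.mul hU.inv hFc)
  refine (continuousOn_integral_of_compact_support (μ := η) (s := U) hk
    (f := fun x k => F (x * k)) (by fun_prop) ?_).continuousAt hUn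
  intro x k hx hk
  by_contra h
  exact hk ⟨x⁻¹, Set.inv_mem_inv.2 hx, x * k, subset_tsupport _ h, by simp⟩

theorem continuous_quotientIntegral (hH : IsClosed (H : Set G)) (η : Measure H)
    [IsHaarMeasure η] {F : G → ℝ} (hF : Continuous F) (hFc : HasCompactSupport F) :
    Continuous (quotientIntegral η F) := by
  rw [QuotientGroup.isOpenQuotientMap_mk.isQuotientMap.continuous_iff]
  exact (continuous_fiberIntegral hH η hF hFc).congr fun x => (quotientIntegral_mk η F x).symm

theorem hasCompactSupport_quotientIntegral (hH : IsClosed (H : Set G)) (η : Measure H)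
    [IsHaarMeasure η] {F : G → ℝ} (hFc : HasCompactSupport F) :
    HasCompactSupport (quotientIntegral η F) := by
  have := t2Space_quotient hH
  refine HasCompactSupport.intro (IsCompact.image hFc
    (QuotientGroup.continuous_mk : Continuous ((↑) : G → G ⧸ H))) fun q hq => ?_
  by_contra h
  obtain ⟨x, rfl⟩ := QuotientGroup.mk_surjective q
  rw [quotientIntegral_mk] at h
  obtain ⟨y, hy, hFy⟩ := exists_of_fiberIntegral_ne_zero h
  exact hq ⟨y, subset_tsupport _ hFy, hy⟩

theorem fiberIntegral_pos (hH : IsClosed (H : Set G)) (η : Measure H)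
    [IsHaarMeasure η] {F : G → ℝ} (hF : Continuous F) (hFc : HasCompactSupport F)
    (hF0 : 0 ≤ F) {x : G} (hx : F x ≠ 0) : 0 < fiberIntegral η F x :=
  (by fun_prop : Continuous fun k : H => F (x * k))
    |>.integral_pos_of_hasCompactSupport_nonneg_nonzero (hasCompactSupport_fiber hH hFc x)
    (fun _ => hF0 _) (x := 1) (by simpa using hx)

/-- The quotient map is open, so translates of a compact neighbourhood of 1 project to
neighbourhoods; finitely many of them cover. -/
theorem exists_isCompact_image_mk_superset {S : Set (G ⧸ H)} (hS : IsCompact S) :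
    ∃ K : Set G, IsCompact K ∧ ∀ q ∈ S, ∃ x ∈ K, (x : G ⧸ H) = q := by
  obtain ⟨U, hU, hUn⟩ := exists_compact_mem_nhds (1 : G)
  have hcov := hS.elim_nhds_subcover (fun q => ((↑) : G → G ⧸ H) '' ((q.out * ·) '' U))
    fun q _ => by
      have h1 : (q.out * ·) '' U ∈ nhds q.out := by
        have := (Homeomorph.mulLeft q.out).isOpenMap.image_mem_nhds hUn
        simpa using this
      have := QuotientGroup.isOpenQuotientMap_mk.isOpenMap.image_mem_nhds (f := ((↑) : G → G ⧸ H)) h1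
      rwa [QuotientGroup.out_eq'] at this
  obtain ⟨t, -, ht⟩ := hcov
  refine ⟨⋃ q ∈ t, (q.out * ·) '' U, t.isCompact_biUnion fun q _ =>
    hU.image (by fun_prop), fun q hq => ?_⟩
  obtain ⟨p, hp, x, hx, rfl⟩ := Set.mem_iUnion₂.1 (ht hq)
  exact ⟨x, Set.mem_iUnion₂.2 ⟨p, hp, hx⟩, rfl⟩

/-- Every compactly supported continuous function on `G ⧸ H` is a fibre integral. -/
theorem exists_fiberIntegral_eq (hH : IsClosed (H : Set G)) (η : Measure H)
    [IsHaarMeasure η] {f : G ⧸ H → ℝ} (hf : Continuous f) (hfc : HasCompactSupport f)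
    (hf0 : 0 ≤ f) : ∃ F : G → ℝ, Continuous F ∧ HasCompactSupport F ∧ 0 ≤ F ∧
      ∀ x, fiberIntegral η F x = f x := by
  obtain ⟨K, hK, hKf⟩ := exists_isCompact_image_mk_superset hfc
  obtain ⟨β, hβ1, -, hβc, hβ01⟩ := exists_continuous_one_zero_of_isCompact hK isClosed_empty
    (Set.disjoint_empty _)
  have hβ0 : 0 ≤ (β : G → ℝ) := fun x => (hβ01 x).1
  have hqc := continuous_quotientIntegral hH η β.continuous hβc
  have hqpos : ∀ q ∈ tsupport f, 0 < quotientIntegral η β q := by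
    intro q hq
    obtain ⟨x, hx, rfl⟩ := hKf q hq
    rw [quotientIntegral_mk]
    exact fiberIntegral_pos hH η β.continuous hβc hβ0 (by simp [hβ1 hx])
  obtain ⟨δ, hδ, hδq⟩ : ∃ δ > 0, ∀ q ∈ tsupport f, δ ≤ quotientIntegral η β q := by
    rcases (tsupport f).eq_empty_or_nonempty with h | h
    · exact ⟨1, one_pos, by simp [h]⟩
    · obtain ⟨q, hq, hmin⟩ := IsCompact.exists_isMinOn hfc h hqc.continuousOn
      exact ⟨_, hqpos q hq, fun p hp => hmin hp⟩
  -- The maximum with `δ` keeps the quotient continuous everywhere and changes nothing on the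
  -- support of `f`.
  let f' : G ⧸ H → ℝ := fun q => f q / max (quotientIntegral η β q) δ
  have hf' : Continuous f' :=
    hf.div (hqc.max continuous_const) fun q => (lt_max_of_lt_right hδ).ne'
  refine ⟨fun x => β x * f' x, β.continuous.mul (hf'.comp QuotientGroup.continuous_mk),
    hβc.mul_right, fun x => mul_nonneg (hβ0 x) (div_nonneg (hf0 _) (le_max_of_le_right hδ.le)),
    fun x => ?_⟩
  rw [fiberIntegral_mul_comp_mk, ← quotientIntegral_mk]
  by_cases hx : (x : G ⧸ H) ∈ tsupport f
  · simp only [f', max_eq_left (hδq _ hx)]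
    rw [mul_div_cancel₀ _ (hqpos _ hx).ne']
  · simp [f', image_eq_zero_of_notMem_tsupport hx]

/-- A compactly supported substitute for a Bruhat function: it is normalized only over a compact
set, which suffices below and needs no paracompactness. -/
theorem exists_fiberIntegral_eq_one (hH : IsClosed (H : Set G)) (η : Measure H)
    [IsHaarMeasure η] {K : Set G} (hK : IsCompact K) :
    ∃ F : G → ℝ, Continuous F ∧ HasCompactSupport F ∧ 0 ≤ F ∧
      (∀ x, fiberIntegral η F x ≤ 1) ∧ ∀ x ∈ K, fiberIntegral η F x = 1 := by
  have := t2Space_quotient hH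
  obtain ⟨f, hf1, -, hfc, hf01⟩ := exists_continuous_one_zero_of_isCompact
    (hK.image (QuotientGroup.continuous_mk : Continuous ((↑) : G → G ⧸ H))) isClosed_empty
    (Set.disjoint_empty _)
  obtain ⟨F, hF, hFc, hF0, hFf⟩ := exists_fiberIntegral_eq hH η f.continuous hfc
    fun q => (hf01 q).1
  exact ⟨F, hF, hFc, hF0, fun x => hFf x ▸ (hf01 _).2, fun x hx => hFf x ▸ hf1 ⟨x, hx, rfl⟩⟩

/-- For a measure which right translations by `H` scale by the modular function of `H`, the fibre
integral is symmetric. -/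
theorem integral_mul_fiberIntegral_comm [LocallyCompactSpace H] (hH : IsClosed (H : Set G))
    (η : Measure H) [IsHaarMeasure η] (κ : Measure G) [IsFiniteMeasureOnCompacts κ]
    (hκ : ∀ F : G → ℝ, Continuous F → HasCompactSupport F → ∀ k : H,
      ∫ x, F (x * k) ∂κ = modularCharacterFun k * ∫ x, F x ∂κ)
    {F F' : G → ℝ} (hF : Continuous F) (hFc : HasCompactSupport F) (hF' : Continuous F')
    (hFc' : HasCompactSupport F') :
    ∫ x, F x * fiberIntegral η F' x ∂κ = ∫ x, fiberIntegral η F x * F' x ∂κ := by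
  calc ∫ x, F x * fiberIntegral η F' x ∂κ
      = ∫ x, ∫ k : H, F x * F' (x * k) ∂η ∂κ := by
        simp only [fiberIntegral, integral_const_mul]
    _ = ∫ k : H, ∫ x, F x * F' (x * k) ∂κ ∂η := by
        refine integral_integral_swap_of_hasCompactSupport (by fun_prop) ?_
        refine HasCompactSupport.intro (IsCompact.prod hFc
          (isCompact_subgroup_preimage hH (IsCompact.mul (IsCompact.inv hFc) hFc'))) ?_
        rintro ⟨x, k⟩ hxk
        by_contra hne
        simp only [Function.uncurry, mul_eq_zero, not_or] at hne
        exact hxk ⟨subset_tsupport _ hne.1, x⁻¹, by simpa using subset_tsupport _ hne.1,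
          x * k, subset_tsupport _ hne.2, by simp⟩
    -- Undoing the translation by `k` costs the modular function of H, which inversion of η cancels
    -- in the last step.
    _ = ∫ k : H, ∫ x, (modularCharacterFun k * F (x * (k⁻¹ : H))) * F' x ∂κ ∂η := by
        refine integral_congr_ae (.of_forall fun k => ?_)
        simp only [mul_assoc, integral_const_mul]
        rw [← hκ (fun x => F (x * (k⁻¹ : H)) * F' x) (by fun_prop) hFc'.mul_left]
        simp
    _ = ∫ x, ∫ k : H, (modularCharacterFun k * F (x * (k⁻¹ : H))) * F' x ∂η ∂κ := by
        have := continuous_modularCharacterFun (Γ := H)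
        refine integral_integral_swap_of_hasCompactSupport (((this.comp continuous_fst).mul
          (by fun_prop : Continuous fun p : H × G => F (p.2 * (p.1⁻¹ : H)))).mul
          (hF'.comp continuous_snd)) ?_
        refine HasCompactSupport.intro (IsCompact.prod (isCompact_subgroup_preimage hH
          (IsCompact.mul (IsCompact.inv hFc) hFc')) hFc') ?_
        rintro ⟨k, x⟩ hxk
        by_contra hne
        simp only [Function.uncurry, mul_eq_zero, not_or] at hne
        exact hxk ⟨⟨(x * (k⁻¹ : H))⁻¹, by simpa using subset_tsupport _ hne.1.2,
          x, subset_tsupport _ hne.2, by simp⟩, subset_tsupport _ hne.2⟩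
    _ = ∫ x, fiberIntegral η F x * F' x ∂κ := by
        refine integral_congr_ae (.of_forall fun x => ?_)
        simp only [integral_mul_const]
        rw [integral_inv_mul_modularCharacterFun η
          (F := fun k : H => F (x * k)) (by fun_prop) (hasCompactSupport_fiber hH hFc x)]
        rfl

end Fiber

/-! ### Linearity and right translation of fibre integrals -/

section FiberLinear

open Measure

variable {G : Type u} [Group G] [TopologicalSpace G] [IsTopologicalGroup G]
  [MeasurableSpace G] [BorelSpace G] [T2Space G] {H : Subgroup G}

theorem integrable_fiber (hH : IsClosed (H : Set G)) (η : Measure H) [IsHaarMeasure η] {F : G → ℝ}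
    (hF : Continuous F) (hFc : HasCompactSupport F) (x : G) :
    Integrable (fun k : H => F (x * k)) η :=
  (by fun_prop : Continuous fun k : H => F (x * k)).integrable_of_hasCompactSupport
    (hasCompactSupport_fiber hH hFc x)

theorem fiberIntegral_add (hH : IsClosed (H : Set G)) (η : Measure H) [IsHaarMeasure η]
    {F F' : G → ℝ} (hF : Continuous F) (hFc : HasCompactSupport F) (hF' : Continuous F')
    (hFc' : HasCompactSupport F') (x : G) :
    fiberIntegral η (fun y => F y + F' y) x = fiberIntegral η F x + fiberIntegral η F' x :=
  integral_add (integrable_fiber hH η hF hFc x) (integrable_fiber hH η hF' hFc' x)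

theorem fiberIntegral_sub (hH : IsClosed (H : Set G)) (η : Measure H) [IsHaarMeasure η]
    {F F' : G → ℝ} (hF : Continuous F) (hFc : HasCompactSupport F) (hF' : Continuous F')
    (hFc' : HasCompactSupport F') (x : G) :
    fiberIntegral η (fun y => F y - F' y) x = fiberIntegral η F x - fiberIntegral η F' x :=
  integral_sub (integrable_fiber hH η hF hFc x) (integrable_fiber hH η hF' hFc' x)

theorem fiberIntegral_const_mul (η : Measure H) (c : ℝ) (F : G → ℝ) (x : G) :
    fiberIntegral η (fun y => c * F y) x = c * fiberIntegral η F x :=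
  integral_const_mul _ _

theorem fiberIntegral_comp_mul_right [LocallyCompactSpace H] (hH : IsClosed (H : Set G))
    (η : Measure H) [IsHaarMeasure η] {F : G → ℝ} (hF : Continuous F) (hFc : HasCompactSupport F)
    (k : H) (x : G) :
    fiberIntegral η (fun y => F (y * k)) x = modularCharacterFun k * fiberIntegral η F x := by
  have := integral_mul_right_eq_modularCharacterFun η (F := fun l : H => F (x * l))
    (by fun_prop) (hasCompactSupport_fiber hH hFc x) k
  simpa [fiberIntegral, mul_assoc] using this

end FiberLinear

/-! ### The Haar measure of `G` and a strongly quasi-invariant measure on `G ⧸ H` -/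

namespace StronglyQuasiInvariantMeasure

open Measure

section

variable {G : Type u} [Group G] [TopologicalSpace G] {X : Type v} [TopologicalSpace X]
  [MulAction G X] [ContinuousConstSMul G X] [MeasurableSpace X] [BorelSpace X]
  (m : StronglyQuasiInvariantMeasure G X)

/-- Change of variables q ↦ gq, since `cocycle g` is the density of the image of μ under g⁻¹. Thus A
↦ `cocycle g` · A(g ·) preserves integrals. -/
theorem integral_cocycle_mul (g : G) (A : X → ℝ) :
    ∫ q, m.cocycle g q * A (g • q) ∂m.μ = ∫ q, A q ∂m.μ := by
  have h1 : ∫ q, A (g • q) ∂(m.μ.map fun x => g⁻¹ • x) = ∫ q, A q ∂m.μ := by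
    have := (Homeomorph.smul g⁻¹ : X ≃ₜ X).measurableEmbedding.integral_map
      (μ := m.μ) (fun q => A (g • q))
    simp only [Homeomorph.smul_apply, smul_inv_smul] at this
    exact this
  rw [← h1, m.map_eq, integral_withDensity_eq_integral_smul
    (m.continuous_cocycle_right g).measurable]
  rfl

theorem integrable_cocycle_mul (g : G) {A : X → ℝ} (hA : Integrable A m.μ) :
    Integrable (fun q => m.cocycle g q * A (g • q)) m.μ := by
  have h1 : Integrable (fun q => A (g • q)) (m.μ.map fun x => g⁻¹ • x) := by
    have := (Homeomorph.smul g⁻¹ : X ≃ₜ X).measurableEmbedding.integrable_map_iff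
      (μ := m.μ) (g := fun q => A (g • q))
    refine this.2 (hA.congr (.of_forall fun q => ?_))
    simp
  rw [m.map_eq, integrable_withDensity_iff_integrable_smul
    (m.continuous_cocycle_right g).measurable] at h1
  exact h1

end

variable {G : Type u} [Group G] [TopologicalSpace G] [IsTopologicalGroup G]
  {H : Subgroup G} [MeasurableSpace (G ⧸ H)] [BorelSpace (G ⧸ H)]
  (m : StronglyQuasiInvariantMeasure G (G ⧸ H))

/-- The action is transitive and preserves null sets, so a non-empty open null set would make every
point locally null, then every compact set null, and then μ = 0 by regularity. -/
theorem isOpenPosMeasure : m.μ.IsOpenPosMeasure := by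
  have := m.regular
  refine ⟨fun U hU ⟨u, hu⟩ h0 => m.ne_zero ?_⟩
  rw [← Measure.measure_univ_eq_zero, isOpen_univ.measure_eq_iSup_isCompact]
  simp only [ENNReal.iSup_eq_zero]
  refine fun K _ hK => hK.measure_zero_of_nhdsWithin fun q _ => ?_
  obtain ⟨g, hg⟩ := MulAction.exists_smul_eq G q u
  refine ⟨(fun x => g⁻¹⁻¹ • x) ⁻¹' U, mem_nhdsWithin_of_mem_nhds ?_,
    (m.quasiMeasurePreserving g⁻¹).preimage_null h0⟩
  refine (hU.preimage (continuous_const_smul _)).mem_nhds ?_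
  simpa [hg] using hu

/-- Both sides are continuous and μ has full support, so the almost everywhere identity holds
everywhere. -/
theorem cocycle_mul_apply (g h : G) (q : G ⧸ H) :
    m.cocycle (g * h) q = m.cocycle g (h • q) * m.cocycle h q := by
  have := m.isOpenPosMeasure
  exact congrFun (Measure.eq_of_ae_eq (m.cocycle_mul g h) (m.continuous_cocycle_right _)
    (((m.continuous_cocycle_right g).comp (continuous_const_smul h)).mul
      (m.continuous_cocycle_right h))) q

/-- The density, with respect to the Haar measure, of the lift of `μ` to `G`. -/
noncomputable def rho (x : G) : ℝ := m.cocycle x ((1 : G) : G ⧸ H)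

theorem rho_pos (x : G) : 0 < m.rho x := m.cocycle_pos _ _

theorem continuous_rho : Continuous m.rho :=
  NNReal.continuous_coe.comp
    (m.continuous_cocycle.comp (continuous_id.prodMk continuous_const))

theorem rho_mul (g x : G) : m.rho (g * x) = m.cocycle g (x : G ⧸ H) * m.rho x := by
  have h : x • ((1 : G) : G ⧸ H) = (x : G ⧸ H) := by
    rw [MulAction.Quotient.smul_coe, smul_eq_mul, mul_one]
  rw [rho, cocycle_mul_apply, h, NNReal.coe_mul, rho]

/-- H fixes the base coset, so the cocycle identity becomes multiplicativity along H. -/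
theorem rho_mul_subgroup (x : G) (k : H) : m.rho (x * k) = m.rho x * m.rho k := by
  have h : ((k : G) : G ⧸ H) = ((1 : G) : G ⧸ H) := QuotientGroup.eq.2 (by simp)
  rw [rho_mul, h]
  rfl

variable [LocallyCompactSpace G] [T2Space G] [MeasurableSpace G] [BorelSpace G]

theorem integrable_quotientIntegral (hH : IsClosed (H : Set G)) (η : Measure H) [IsHaarMeasure η]
    {F : G → ℝ} (hF : Continuous F) (hFc : HasCompactSupport F) :
    Integrable (quotientIntegral η F) m.μ := by
  have := m.regular
  exact (continuous_quotientIntegral hH η hF hFc).integrable_of_hasCompactSupport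
    (hasCompactSupport_quotientIntegral hH η hFc)

open CompactlySupported in
/-- Weil's formula: the lift of `μ` to `G` has density `rho` with respect to some Haar measure. -/
theorem exists_haar_integral_rho_mul (hH : IsClosed (H : Set G)) (η : Measure H)
    [IsHaarMeasure η] : ∃ ν : Measure G, IsHaarMeasure ν ∧ ν.Regular ∧ ∀ F : G → ℝ, Continuous F →
      HasCompactSupport F → ∫ x, m.rho x * F x ∂ν = ∫ q, quotientIntegral η F q ∂m.μ := by
  have hd : ∀ F : C_c(G, ℝ), Continuous fun x => F x / m.rho x := fun F =>
    F.continuous.div m.continuous_rho fun x => (m.rho_pos x).ne'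
  have hdc : ∀ F : C_c(G, ℝ), HasCompactSupport fun x => F x / m.rho x := fun F =>
    F.hasCompactSupport.mono fun x hx => by
      simp only [Function.mem_support, ne_eq, div_eq_zero_iff, not_or] at hx
      exact hx.1
  -- Integrating F/ρ over the fibres and then over G/H is left invariant: the cocycle picked up by ρ
  -- is exactly the one in the change of variables on G/H. Its Riesz measure is the required Haar
  -- measure.
  let L : C_c(G, ℝ) →ₗ[ℝ] ℝ :=
    { toFun := fun F => ∫ q, quotientIntegral η (fun x => F x / m.rho x) q ∂m.μ
      map_add' := fun F F' => by
        rw [← integral_add (m.integrable_quotientIntegral hH η (hd F) (hdc F))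
          (m.integrable_quotientIntegral hH η (hd F') (hdc F'))]
        refine integral_congr_ae (.of_forall fun q => ?_)
        refine Eq.trans ?_ (fiberIntegral_add hH η (hd F) (hdc F) (hd F') (hdc F') _)
        simp only [CompactlySupportedContinuousMap.add_apply, add_div, quotientIntegral]
      map_smul' := fun c F => by
        simp only [CompactlySupportedContinuousMap.smul_apply, smul_eq_mul, mul_div_assoc,
          quotientIntegral, fiberIntegral_const_mul, integral_const_mul, RingHom.id_apply] }
  have hL : ∀ F, L F = ∫ q, quotientIntegral η (fun x => F x / m.rho x) q ∂m.μ := fun F => rfl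
  have hL0 : ∀ F, 0 ≤ F → 0 ≤ L F := fun F hF => integral_nonneg fun q =>
    fiberIntegral_nonneg η (fun x => div_nonneg (hF x) (m.rho_pos x).le) _
  let Λ : C_c(G, ℝ) →ₚ[ℝ] ℝ := PositiveLinearMap.mk₀ L hL0
  let ν := RealRMK.rieszMeasure Λ
  have hν : ∀ F : C_c(G, ℝ), ∫ x, F x ∂ν = L F := fun F => RealRMK.integral_rieszMeasure Λ F
  have hweil : ∀ F : G → ℝ, Continuous F → HasCompactSupport F →
      ∫ x, m.rho x * F x ∂ν = ∫ q, quotientIntegral η F q ∂m.μ := by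
    intro F hF hFc
    have h := hν ⟨⟨fun x => m.rho x * F x, m.continuous_rho.mul hF⟩, hFc.mul_left⟩
    simp only [CompactlySupportedContinuousMap.coe_mk, ContinuousMap.coe_mk] at h
    rw [h, hL]
    simp only [CompactlySupportedContinuousMap.coe_mk, ContinuousMap.coe_mk,
      mul_div_cancel_left₀ _ (m.rho_pos _).ne']
  have hinv : ∀ g : G, ∀ F : C_c(G, ℝ), ∫ x, F (g * x) ∂ν = ∫ x, F x ∂ν := by
    intro g F
    have h := hν ⟨⟨fun x => F (g * x), by fun_prop⟩,
      hasCompactSupport_mul_left F.hasCompactSupport g⟩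
    simp only [CompactlySupportedContinuousMap.coe_mk, ContinuousMap.coe_mk] at h
    rw [h, hν, hL, hL]
    simp only [CompactlySupportedContinuousMap.coe_mk,
      ContinuousMap.coe_mk]
    refine Eq.trans ?_ (m.integral_cocycle_mul g _)
    refine integral_congr_ae (.of_forall fun q => ?_)
    obtain ⟨x, rfl⟩ := QuotientGroup.mk_surjective q
    simp only [MulAction.Quotient.smul_coe, smul_eq_mul, quotientIntegral_mk]
    have h2 : ∀ y : G, F (g * y) / m.rho y
        = F (g * y) / m.rho (g * y) * m.cocycle g (y : G ⧸ H) := by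
      intro y
      have h3 := (m.rho_pos y).ne'
      have h4 : (m.cocycle g (y : G ⧸ H) : ℝ) ≠ 0 :=
        NNReal.coe_ne_zero.2 (m.cocycle_pos g (y : G ⧸ H)).ne'
      rw [rho_mul]
      field_simp
    simp only [h2]
    rw [fiberIntegral_mul_comp_mk η (fun y => F (g * y) / m.rho (g * y))
      (fun q => (m.cocycle g q : ℝ)), mul_comm]
    simp only [fiberIntegral, mul_assoc]
  have hreg : ν.Regular := RealRMK.regular_rieszMeasure Λ
  have hleft : ν.IsMulLeftInvariant := by
    refine ⟨fun g => ?_⟩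
    have : (ν.map (g * ·)).Regular := Regular.map (Homeomorph.mulLeft g)
    refine Measure.ext_of_integral_eq_on_compactlySupported fun F => ?_
    exact (integral_map (by fun_prop) F.continuous.aestronglyMeasurable).trans (hinv g F)
  have hne : ν ≠ 0 := by
    intro h0
    obtain ⟨F, hF, hFc, hF0, -, hF1⟩ := exists_fiberIntegral_eq_one hH η
      (isCompact_singleton (x := (1 : G)))
    have h := hweil F hF hFc
    rw [h0, integral_zero_measure] at h
    have := m.isOpenPosMeasure
    have := m.regular
    refine (Continuous.integral_pos_of_hasCompactSupport_nonneg_nonzero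
      (continuous_quotientIntegral hH η hF hFc)
      (hasCompactSupport_quotientIntegral hH η hFc)
      (fun q => fiberIntegral_nonneg η hF0 _) (x := ((1 : G) : G ⧸ H)) ?_).ne h
    rw [quotientIntegral_mk, hF1 1 rfl]
    exact one_ne_zero
  have : NeZero ν := ⟨hne⟩
  have hpos : ν.IsOpenPosMeasure := isOpenPosMeasure_of_mulLeftInvariant_of_regular
  exact ⟨ν, { toIsFiniteMeasureOnCompacts := inferInstance }, hreg, hweil⟩

/-- The density `rho` restricts on `H` to the quotient of the modular functions. -/
theorem rho_mul_modularCharacterFun [LocallyCompactSpace H] (hH : IsClosed (H : Set G))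
    (η : Measure H) [IsHaarMeasure η] {ν : Measure G} [IsHaarMeasure ν]
    (hν : ∀ F : G → ℝ, Continuous F → HasCompactSupport F →
      ∫ x, m.rho x * F x ∂ν = ∫ q, quotientIntegral η F q ∂m.μ) (k : H) :
    m.rho k * modularCharacterFun k = modularCharacterFun (k : G) := by
  obtain ⟨⟨F, hF⟩, hFc, hF0, hF1⟩ :
    ∃ f : C(G, ℝ), HasCompactSupport f ∧ 0 ≤ f ∧ f 1 ≠ 0 := exists_continuous_nonneg_pos 1
  simp only [ContinuousMap.coe_mk] at hF1 hFc
  have hρ := m.continuous_rho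
  have hpos : 0 < ∫ x, m.rho x * F x ∂ν :=
    (hρ.mul hF).integral_pos_of_hasCompactSupport_nonneg_nonzero hFc.mul_left
      (fun x => mul_nonneg (m.rho_pos x).le (hF0 x)) (mul_ne_zero (m.rho_pos 1).ne' hF1)
  refine mul_right_cancel₀ hpos.ne' ?_
  -- Right translation by `k` is evaluated twice: on the fibres it gives the modular function of H,
  -- on G that of G together with ρ(k).
  have h1 := hν (fun x => F (x * k)) (by fun_prop) (hasCompactSupport_mul_right hFc _)
  simp only [quotientIntegral, fiberIntegral_comp_mul_right hH η hF hFc,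
    integral_const_mul] at h1
  have h2 := integral_mul_right_eq_modularCharacterFun ν (hρ.mul hF) hFc.mul_left (k : G)
  simp only [Pi.mul_apply] at h2
  rw [← h2, hν F hF hFc]
  simp only [quotientIntegral]
  rw [mul_assoc, ← h1, ← integral_const_mul]
  refine integral_congr_ae (.of_forall fun x => ?_)
  simp only [rho_mul_subgroup]
  ring

end StronglyQuasiInvariantMeasure

/-! ### The induced convex compact `G`-space -/

section Induced

open Measure
open scoped CompactlySupported

variable {G : Type u} [Group G] [TopologicalSpace G] [IsTopologicalGroup G]
  {H : Subgroup G}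

/-- Left translation of a compactly supported function, `x ↦ F (g⁻¹ x)`. -/
def leftTranslate (g : G) (F : C_c(G, ℝ)) : C_c(G, ℝ) :=
  ⟨⟨fun x => F (g⁻¹ * x), by fun_prop⟩, hasCompactSupport_mul_left F.hasCompactSupport g⁻¹⟩

/-- Right translation of a compactly supported function, `x ↦ F (x g⁻¹)`. -/
def rightTranslate (g : G) (F : C_c(G, ℝ)) : C_c(G, ℝ) :=
  ⟨⟨fun x => F (x * g⁻¹), by fun_prop⟩, hasCompactSupport_mul_right F.hasCompactSupport g⁻¹⟩

@[simp] theorem leftTranslate_apply (g : G) (F : C_c(G, ℝ)) (x : G) :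
    leftTranslate g F x = F (g⁻¹ * x) := rfl

@[simp] theorem rightTranslate_apply (g : G) (F : C_c(G, ℝ)) (x : G) :
    rightTranslate g F x = F (x * g⁻¹) := rfl

/-- Translation of a bounded continuous function, `x ↦ φ (h x)`. -/
def translateBounded (h : H) (φ : H →ᵇ ℝ) : H →ᵇ ℝ :=
  φ.compContinuous ⟨fun x => h * x, by fun_prop⟩

@[simp] theorem translateBounded_apply (h : H) (φ : H →ᵇ ℝ) (x : H) :
    translateBounded h φ x = φ (h * x) := rfl

variable [MeasurableSpace G] [BorelSpace G]

/-- `T` is given by an essentially bounded `H`-equivariant map from `G` to the positive functionals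
of norm at most one on the bounded continuous functions on `H`, paired with the measure `ν`. -/
structure IsEquivariantFamily (H : Subgroup G) (ν : Measure G)
    (T : C_c(G, ℝ) × (H →ᵇ ℝ) → ℝ) : Prop where
  add_left : ∀ F F' φ, T (F + F', φ) = T (F, φ) + T (F', φ)
  smul_left : ∀ (c : ℝ) F φ, T (c • F, φ) = c * T (F, φ)
  add_right : ∀ F φ φ', T (F, φ + φ') = T (F, φ) + T (F, φ')
  smul_right : ∀ (c : ℝ) F φ, T (F, c • φ) = c * T (F, φ)
  nonneg : ∀ F φ, 0 ≤ F → 0 ≤ φ → 0 ≤ T (F, φ)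
  bound : ∀ F φ, |T (F, φ)| ≤ ‖φ‖ * ∫ x, |F x| ∂ν
  equivariant : ∀ (h : H) F φ, T (leftTranslate (h : G) F, φ) = T (F, translateBounded h φ)

theorem isClosed_setOf_isEquivariantFamily (ν : Measure G) :
    IsClosed {T | IsEquivariantFamily H ν T} := by
  have h : {T | IsEquivariantFamily H ν T} =
      {T | (∀ F F' φ, T (F + F', φ) = T (F, φ) + T (F', φ)) ∧
        (∀ (c : ℝ) F φ, T (c • F, φ) = c * T (F, φ)) ∧
        (∀ F φ φ', T (F, φ + φ') = T (F, φ) + T (F, φ')) ∧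
        (∀ (c : ℝ) F φ, T (F, c • φ) = c * T (F, φ)) ∧
        (∀ F φ, 0 ≤ F → 0 ≤ φ → 0 ≤ T (F, φ)) ∧
        (∀ F φ, |T (F, φ)| ≤ ‖φ‖ * ∫ x, |F x| ∂ν) ∧
        (∀ (h : H) F φ, T (leftTranslate (h : G) F, φ) = T (F, translateBounded h φ))} := by
    ext T
    exact ⟨fun ⟨a, b, c, d, e, f, g⟩ => ⟨a, b, c, d, e, f, g⟩,
      fun ⟨a, b, c, d, e, f, g⟩ => ⟨a, b, c, d, e, f, g⟩⟩
  rw [h]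
  simp only [Set.ofPred_and, Set.ofPred_forall]
  refine IsClosed.inter ?_ (IsClosed.inter ?_ (IsClosed.inter ?_ (IsClosed.inter ?_
    (IsClosed.inter ?_ (IsClosed.inter ?_ ?_)))))
  all_goals
    repeat refine isClosed_iInter fun _ => ?_
    first
      | exact isClosed_eq (by fun_prop) (by fun_prop)
      | exact isClosed_le (by fun_prop) (by fun_prop)

theorem IsEquivariantFamily.convexComb {ν : Measure G} {T T' : C_c(G, ℝ) × (H →ᵇ ℝ) → ℝ}
    (hT : IsEquivariantFamily H ν T) (hT' : IsEquivariantFamily H ν T') {a b : ℝ} (ha : 0 ≤ a)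
    (hb : 0 ≤ b) (hab : a + b = 1) : IsEquivariantFamily H ν (a • T + b • T') where
  add_left F F' φ := by
    simp only [Pi.add_apply, Pi.smul_apply, smul_eq_mul, hT.add_left, hT'.add_left]; ring
  smul_left c F φ := by
    simp only [Pi.add_apply, Pi.smul_apply, smul_eq_mul, hT.smul_left, hT'.smul_left]; ring
  add_right F φ φ' := by
    simp only [Pi.add_apply, Pi.smul_apply, smul_eq_mul, hT.add_right, hT'.add_right]; ring
  smul_right c F φ := by
    simp only [Pi.add_apply, Pi.smul_apply, smul_eq_mul, hT.smul_right, hT'.smul_right]; ring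
  nonneg F φ hF hφ :=
    add_nonneg (mul_nonneg ha (hT.nonneg F φ hF hφ)) (mul_nonneg hb (hT'.nonneg F φ hF hφ))
  bound F φ := by
    simp only [Pi.add_apply, Pi.smul_apply, smul_eq_mul]
    refine (abs_add_le _ _).trans ?_
    rw [abs_mul, abs_mul, abs_of_nonneg ha, abs_of_nonneg hb]
    calc a * |T (F, φ)| + b * |T' (F, φ)|
        ≤ a * (‖φ‖ * ∫ x, |F x| ∂ν) + b * (‖φ‖ * ∫ x, |F x| ∂ν) := by
          gcongr
          exacts [hT.bound F φ, hT'.bound F φ]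
      _ = _ := by rw [← add_mul, hab, one_mul]
  equivariant h F φ := by
    simp only [Pi.add_apply, Pi.smul_apply, smul_eq_mul, hT.equivariant, hT'.equivariant]

theorem IsEquivariantFamily.sub_le {ν : Measure G} {T : C_c(G, ℝ) × (H →ᵇ ℝ) → ℝ}
    (hT : IsEquivariantFamily H ν T) (F F' : C_c(G, ℝ)) (φ : H →ᵇ ℝ) :
    |T (F, φ) - T (F', φ)| ≤ ‖φ‖ * ∫ x, |F x - F' x| ∂ν := by
  have h := hT.bound (F + (-1 : ℝ) • F') φ
  rw [hT.add_left, hT.smul_left] at h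
  simpa [sub_eq_add_neg] using h

/-- The set of normalized equivariant families. -/
def inducedSet (H : Subgroup G) (ν : Measure G) : Set (C_c(G, ℝ) × (H →ᵇ ℝ) → ℝ) :=
  {T | IsEquivariantFamily H ν T ∧ ∀ F, T (F, 1) = ∫ x, F x ∂ν}

/-- The norm bound confines each coordinate to a compact interval, so Tychonoff's theorem applies.
-/
theorem isCompact_setOf_isEquivariantFamily (ν : Measure G) :
    IsCompact {T | IsEquivariantFamily H ν T} := by
  refine (isCompact_univ_pi (s := fun p : C_c(G, ℝ) × (H →ᵇ ℝ) =>
    Set.Icc (-(‖p.2‖ * ∫ x, |p.1 x| ∂ν)) (‖p.2‖ * ∫ x, |p.1 x| ∂ν))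
    fun p => isCompact_Icc).of_isClosed_subset (isClosed_setOf_isEquivariantFamily ν) ?_
  intro T hT p _
  exact abs_le.1 (hT.bound p.1 p.2)

theorem isCompact_inducedSet (ν : Measure G) : IsCompact (inducedSet H ν) := by
  have h : IsClosed {T : C_c(G, ℝ) × (H →ᵇ ℝ) → ℝ | ∀ F, T (F, 1) = ∫ x, F x ∂ν} := by
    simp only [Set.ofPred_forall]
    exact isClosed_iInter fun F => isClosed_eq (by fun_prop) (by fun_prop)
  exact (isCompact_setOf_isEquivariantFamily ν).inter_right h

theorem convex_inducedSet (ν : Measure G) : Convex ℝ (inducedSet H ν) := by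
  intro T hT T' hT' a b ha hb hab
  refine ⟨hT.1.convexComb hT'.1 ha hb hab, fun F => ?_⟩
  simp only [Pi.add_apply, Pi.smul_apply, smul_eq_mul, hT.2, hT'.2]
  rw [← add_mul, hab, one_mul]

variable [LocallyCompactSpace G] [T2Space G]

theorem modularCharacterFun_inv_mul_self (g : G) :
    (modularCharacterFun g⁻¹ : ℝ) * modularCharacterFun g = 1 := by
  rw [← NNReal.coe_mul, ← modularCharacterFun_map_mul]
  simp [modularCharacterFun_map_one]

theorem integral_rightTranslate (ν : Measure G) [IsHaarMeasure ν] {F : G → ℝ} (hF : Continuous F)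
    (hFc : HasCompactSupport F) (g : G) :
    modularCharacterFun g * ∫ x, F (x * g⁻¹) ∂ν = ∫ x, F x ∂ν := by
  rw [integral_mul_right_eq_modularCharacterFun ν hF hFc, ← mul_assoc, mul_comm (_ : ℝ) (_ : ℝ≥0),
    modularCharacterFun_inv_mul_self, one_mul]

/-- The action of `g` on families. -/
noncomputable def inducedMap (H : Subgroup G) (g : G) :
    (C_c(G, ℝ) × (H →ᵇ ℝ) → ℝ) →ₗ[ℝ] (C_c(G, ℝ) × (H →ᵇ ℝ) → ℝ) where
  -- The modular factor makes this Φ ↦ Φ(· g) for the underlying map: ∫ F(xg⁻¹) Φ(x) dν equals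
  -- Δ(g)⁻¹ ∫ F(x) Φ(xg) dν.
  toFun T p := modularCharacterFun g * T (rightTranslate g p.1, p.2)
  map_add' T T' := by funext p; simp [mul_add]
  map_smul' c T := by funext p; simp [mul_left_comm]

theorem inducedMap_apply (g : G) (T : C_c(G, ℝ) × (H →ᵇ ℝ) → ℝ) (p : C_c(G, ℝ) × (H →ᵇ ℝ)) :
    inducedMap H g T p = modularCharacterFun g * T (rightTranslate g p.1, p.2) := rfl

theorem inducedMap_mul (g g' : G) (T : C_c(G, ℝ) × (H →ᵇ ℝ) → ℝ) :
    inducedMap H (g * g') T = inducedMap H g (inducedMap H g' T) := by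
  funext p
  have : rightTranslate (g * g') p.1 = rightTranslate g' (rightTranslate g p.1) := by
    ext x; simp [mul_assoc]
  simp only [inducedMap_apply, modularCharacterFun_map_mul, NNReal.coe_mul, this, mul_assoc]

theorem inducedMap_one (T : C_c(G, ℝ) × (H →ᵇ ℝ) → ℝ) : inducedMap H 1 T = T := by
  funext p
  have : rightTranslate 1 p.1 = p.1 := by ext x; simp
  simp [inducedMap_apply, modularCharacterFun_map_one, this]

/-- The action of `G` on families, as an affine representation. -/
noncomputable def inducedRep (H : Subgroup G) :
    G →* ((C_c(G, ℝ) × (H →ᵇ ℝ) → ℝ) ≃ᵃ[ℝ] (C_c(G, ℝ) × (H →ᵇ ℝ) → ℝ)) where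
  toFun g := (LinearEquiv.ofLinearMap (inducedMap H g) (inducedMap H g⁻¹)
    (by ext1 T; simp [← inducedMap_mul, inducedMap_one])
    (by ext1 T; simp [← inducedMap_mul, inducedMap_one])).toAffineEquiv
  map_one' := by ext1 T; exact inducedMap_one T
  map_mul' g g' := by ext1 T; exact inducedMap_mul g g' T

theorem inducedRep_apply (g : G) (T : C_c(G, ℝ) × (H →ᵇ ℝ) → ℝ) :
    inducedRep H g T = inducedMap H g T := rfl

/-- Right translations commute with left ones, so equivariance survives; the modular factor
preserves the bound and the normalization. -/
theorem inducedMap_mem {ν : Measure G} [IsHaarMeasure ν] (g : G)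
    {T : C_c(G, ℝ) × (H →ᵇ ℝ) → ℝ} (hT : T ∈ inducedSet H ν) :
    inducedMap H g T ∈ inducedSet H ν := by
  obtain ⟨hT, hT1⟩ := hT
  have hadd : ∀ F F', rightTranslate g (F + F') = rightTranslate g F + rightTranslate g F' :=
    fun F F' => by ext x; simp
  have hsmul : ∀ (c : ℝ) F, rightTranslate g (c • F) = c • rightTranslate g F :=
    fun c F => by ext x; simp
  have hleft : ∀ (h : G) F,
      rightTranslate g (leftTranslate h F) = leftTranslate h (rightTranslate g F) :=
    fun h F => by ext x; simp [mul_assoc]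
  refine ⟨⟨fun F F' φ => ?_, fun c F φ => ?_, fun F φ φ' => ?_, fun c F φ => ?_,
    fun F φ hF hφ => ?_, fun F φ => ?_, fun h F φ => ?_⟩, fun F => ?_⟩
  · simp only [inducedMap_apply, hadd, hT.add_left, mul_add]
  · simp only [inducedMap_apply, hsmul, hT.smul_left]; ring
  · simp only [inducedMap_apply, hT.add_right, mul_add]
  · simp only [inducedMap_apply, hT.smul_right]; ring
  · exact mul_nonneg (NNReal.coe_nonneg _) (hT.nonneg _ _ (fun x => hF (x * g⁻¹)) hφ)
  · rw [inducedMap_apply, abs_mul, abs_of_nonneg (NNReal.coe_nonneg _)]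
    refine (mul_le_mul_of_nonneg_left (hT.bound _ _) (NNReal.coe_nonneg _)).trans_eq ?_
    rw [← integral_rightTranslate ν (F := fun x => |F x|) F.continuous.abs
      (F.hasCompactSupport.comp_left abs_zero) g]
    simp only [rightTranslate_apply]
    ring
  · simp only [inducedMap_apply, hleft, hT.equivariant]
  · rw [inducedMap_apply, hT1,
      ← integral_rightTranslate ν (F := F) F.continuous F.hasCompactSupport g]
    rfl

/-- The bound makes the families uniformly Lipschitz in `F` for the L¹-norm, in which right
translation is continuous; this upgrades pointwise to joint continuity. -/
theorem continuousOn_inducedMap (ν : Measure G) [IsHaarMeasure ν] :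
    ContinuousOn (fun p : G × (C_c(G, ℝ) × (H →ᵇ ℝ) → ℝ) => inducedMap H p.1 p.2)
      (Set.univ ×ˢ inducedSet H ν) := by
  refine continuousOn_pi.2 fun ⟨F, φ⟩ => ?_
  simp only [inducedMap_apply]
  refine (continuous_modularCharacterFun.comp continuous_fst).continuousOn.mul ?_
  rintro ⟨g₀, T₀⟩ -
  have h1 : Filter.Tendsto (fun p : G × (C_c(G, ℝ) × (H →ᵇ ℝ) → ℝ) => p.2 (rightTranslate g₀ F, φ))
      (nhdsWithin (g₀, T₀) (Set.univ ×ˢ inducedSet H ν)) (nhds (T₀ (rightTranslate g₀ F, φ))) :=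
    (((continuous_apply (rightTranslate g₀ F, φ)).comp continuous_snd).tendsto
      (g₀, T₀)).mono_left nhdsWithin_le_nhds
  have hc : Continuous fun g : G =>
      ‖φ‖ * ∫ x, |rightTranslate g F x - rightTranslate g₀ F x| ∂ν :=
    continuous_const.mul ((continuous_integral_dist_mul_right ν F.continuous F.hasCompactSupport
      (N := fun a b => |a - b|) (by fun_prop) (by simp) g₀⁻¹).comp continuous_inv)
  have h2 : Filter.Tendsto (fun p : G × (C_c(G, ℝ) × (H →ᵇ ℝ) → ℝ) =>
      p.2 (rightTranslate p.1 F, φ) - p.2 (rightTranslate g₀ F, φ))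
      (nhdsWithin (g₀, T₀) (Set.univ ×ˢ inducedSet H ν)) (nhds 0) := by
    refine squeeze_zero_norm' (a := fun p =>
      ‖φ‖ * ∫ x, |rightTranslate p.1 F x - rightTranslate g₀ F x| ∂ν) ?_ ?_
    · filter_upwards [self_mem_nhdsWithin] with p hp
      exact hp.2.1.sub_le _ _ _
    · have := ((hc.comp continuous_fst).tendsto (g₀, T₀)).mono_left
        (nhdsWithin_le_nhds (s := Set.univ ×ˢ inducedSet H ν))
      simpa [Function.comp_def] using this
  have h3 := h1.add h2
  simp only [add_zero, add_sub_cancel] at h3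
  exact h3

/-- The induced convex compact `G`-space. -/
noncomputable def inducedSpace (H : Subgroup G) (ν : Measure G) [IsHaarMeasure ν] :
    ConvexCompactGSpace G (C_c(G, ℝ) × (H →ᵇ ℝ) → ℝ) where
  carrier := inducedSet H ν
  convex := convex_inducedSet ν
  isCompact := isCompact_inducedSet ν
  rep := inducedRep H
  continuous_rep g := by
    refine continuous_pi fun p => ?_
    simp only [inducedRep_apply, inducedMap_apply]
    fun_prop
  mapsTo g T hT := inducedMap_mem g hT
  continuousOn := continuousOn_inducedMap ν

theorem continuous_fiberIntegral_mul (hH : IsClosed (H : Set G)) (η : Measure H)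
    [IsHaarMeasure η] {F : G → ℝ} (hF : Continuous F) (hFc : HasCompactSupport F)
    (φ : H →ᵇ ℝ) : Continuous fun x : G => ∫ k : H, φ k * F (x * k) ∂η := by
  refine continuous_iff_continuousAt.2 fun x₀ => ?_
  obtain ⟨U, hU, hUn⟩ := exists_compact_mem_nhds x₀
  have hk := isCompact_subgroup_preimage hH (IsCompact.mul hU.inv hFc)
  refine (continuousOn_integral_of_compact_support (μ := η) (s := U) hk
    (f := fun x k => φ k * F (x * k)) (by fun_prop) ?_).continuousAt hUn
  intro x k hx hk
  by_contra h
  exact hk ⟨x⁻¹, Set.inv_mem_inv.2 hx, x * k, subset_tsupport _ (right_ne_zero_of_mul h), by simp⟩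

/-- Equivariant families which are normalized on a given compact set. -/
theorem exists_isEquivariantFamily (hH : IsClosed (H : Set G)) (η : Measure H)
    [IsHaarMeasure η] (ν : Measure G) [IsHaarMeasure ν] {K : Set G} (hK : IsCompact K) :
    ∃ T, IsEquivariantFamily H ν T ∧
      ∀ F : C_c(G, ℝ), tsupport F ⊆ K → T (F, 1) = ∫ x, F x ∂ν := by
  obtain ⟨b, hb, hbc, hb0, hb1, hbK⟩ := exists_fiberIntegral_eq_one hH η hK.inv
  -- Here Φ(x) is the measure b(x⁻¹k) dη(k) on H: equivariant by left invariance of η, of mass at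
  -- most one, and of mass exactly one for `x` in `K`.
  let s : (H →ᵇ ℝ) → G → ℝ := fun φ x => ∫ k : H, φ k * b (x⁻¹ * k) ∂η
  have hs : ∀ φ, Continuous (s φ) := fun φ =>
    (continuous_fiberIntegral_mul hH η hb hbc φ).comp continuous_inv
  have hint : ∀ (φ : H →ᵇ ℝ) (x : G), Integrable (fun k : H => φ k * b (x⁻¹ * k)) η := fun φ x =>
    (by fun_prop : Continuous fun k : H => φ k * b (x⁻¹ * k)).integrable_of_hasCompactSupport
      (hasCompactSupport_fiber hH hbc x⁻¹).mul_left
  have hsi : ∀ (F : C_c(G, ℝ)) φ, Integrable (fun x => F x * s φ x) ν := fun F φ =>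
    (F.continuous.mul (hs φ)).integrable_of_hasCompactSupport F.hasCompactSupport.mul_right
  have hsb : ∀ φ x, |s φ x| ≤ ‖φ‖ := by
    intro φ x
    calc |s φ x| ≤ ∫ k : H, ‖φ‖ * b (x⁻¹ * k) ∂η := by
          refine norm_integral_le_of_norm_le (f := fun k : H => φ k * b (x⁻¹ * k))
            ((integrable_fiber hH η hb hbc x⁻¹).const_mul _) (.of_forall fun k => ?_)
          rw [norm_mul, Real.norm_of_nonneg (hb0 _)]
          exact mul_le_mul_of_nonneg_right (φ.norm_coe_le_norm k) (hb0 _)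
      _ = ‖φ‖ * fiberIntegral η b x⁻¹ := integral_const_mul _ _
      _ ≤ ‖φ‖ := mul_le_of_le_one_right (norm_nonneg _) (hb1 _)
  refine ⟨fun p => ∫ x, p.1 x * s p.2 x ∂ν, ⟨fun F F' φ => ?_, fun c F φ => ?_, fun F φ φ' => ?_,
    fun c F φ => ?_, fun F φ hF hφ => ?_, fun F φ => ?_, fun h F φ => ?_⟩, fun F hF => ?_⟩
  · simp only [CompactlySupportedContinuousMap.add_apply, add_mul]
    exact integral_add (hsi F φ) (hsi F' φ)
  · simp only [CompactlySupportedContinuousMap.smul_apply, smul_eq_mul, mul_assoc]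
    exact integral_const_mul _ _
  · have : ∀ x, s (φ + φ') x = s φ x + s φ' x := fun x => by
      simp only [s, BoundedContinuousFunction.add_apply, add_mul]
      exact integral_add (hint φ x) (hint φ' x)
    simp only [this, mul_add]
    exact integral_add (hsi F φ) (hsi F φ')
  · have : ∀ x, s (c • φ) x = c * s φ x := fun x => by
      simp only [s, BoundedContinuousFunction.smul_apply, smul_eq_mul, mul_assoc]
      exact integral_const_mul _ _
    simp only [this, mul_left_comm]
    exact integral_const_mul _ _
  · exact integral_nonneg fun x => mul_nonneg (hF x)
      (integral_nonneg fun k => mul_nonneg (hφ k) (hb0 _))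
  · simp only
    rw [← integral_const_mul]
    have hi : Integrable (fun x => |F x|) ν :=
      F.continuous.abs.integrable_of_hasCompactSupport (F.hasCompactSupport.comp_left abs_zero)
    refine norm_integral_le_of_norm_le (f := fun x => F x * s φ x) (hi.const_mul _)
      (.of_forall fun x => ?_)
    rw [norm_mul, mul_comm]
    exact mul_le_mul_of_nonneg_right (hsb φ x) (norm_nonneg _)
  · have hst : ∀ x, s φ (h * x) = s (translateBounded h φ) x := fun x => by
      simp only [s, translateBounded_apply]
      rw [← integral_mul_left_eq_self _ h]
      simp [mul_assoc]
    simp only [leftTranslate_apply, ← hst]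
    rw [← integral_mul_left_eq_self _ (h : G)]
    simp
  · refine integral_congr_ae (.of_forall fun x => ?_)
    by_cases hx : F x = 0
    · simp [hx]
    · have : s 1 x = 1 := by
        simp only [s, BoundedContinuousFunction.coe_one, Pi.one_apply, one_mul]
        exact hbK _ (Set.inv_mem_inv.2 (hF (subset_tsupport _ hx)))
      simp [this]

/-- Families normalized on larger and larger compact sets form a directed system of non-empty
compact sets; a common point is normalized on every test function. -/
theorem inducedSet_nonempty (hH : IsClosed (H : Set G)) (η : Measure H)
    [IsHaarMeasure η] (ν : Measure G) [IsHaarMeasure ν] : (inducedSet H ν).Nonempty := by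
  let Z : TopologicalSpace.Compacts G → Set (C_c(G, ℝ) × (H →ᵇ ℝ) → ℝ) := fun K =>
    {T | IsEquivariantFamily H ν T} ∩ {T | ∀ F : C_c(G, ℝ), tsupport F ⊆ K →
      T (F, 1) = ∫ x, F x ∂ν}
  have hZ : ∀ K, IsCompact (Z K) := by
    intro K
    refine (isCompact_setOf_isEquivariantFamily ν).inter_right ?_
    simp only [Set.ofPred_forall]
    exact isClosed_iInter fun F => isClosed_iInter fun _ =>
      isClosed_eq (by fun_prop) (by fun_prop)
  have hdir : Directed (· ⊇ ·) Z := fun K K' =>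
    ⟨K ⊔ K', fun T hT => ⟨hT.1, fun F hF => hT.2 F (hF.trans Set.subset_union_left)⟩,
      fun T hT => ⟨hT.1, fun F hF => hT.2 F (hF.trans Set.subset_union_right)⟩⟩
  obtain ⟨T, hT⟩ := IsCompact.nonempty_iInter_of_directed_nonempty_isCompact_isClosed Z hdir
    (fun K => exists_isEquivariantFamily hH η ν K.isCompact) hZ fun K => (hZ K).isClosed
  rw [Set.mem_iInter] at hT
  exact ⟨T, (hT ⊥).1, fun F => (hT ⟨tsupport F, F.hasCompactSupport⟩).2 F subset_rfl⟩

/-- A relatively amenable subgroup `H` fixes a point of the induced space. -/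
theorem exists_invariant_of_relativelyAmenable (hH : IsClosed (H : Set G)) (η : Measure H)
    [IsHaarMeasure η] (ν : Measure G) [IsHaarMeasure ν] (hR : RelativelyAmenable.{u, u} H) :
    ∃ T ∈ inducedSet H ν, ∀ (h : H) F φ,
      modularCharacterFun (h : G) * T (rightTranslate (h : G) F, φ) = T (F, φ) := by
  obtain ⟨T, hT, hinv⟩ := hR _ (inducedSpace H ν) (inducedSet_nonempty hH η ν)
  exact ⟨T, hT, fun h F φ => congrFun (hinv h h.2) (F, φ)⟩

end Induced

/-! ### Descent of invariant families to the quotient -/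

namespace StronglyQuasiInvariantMeasure

open Measure
open scoped CompactlySupported

variable {G : Type u} [Group G] [TopologicalSpace G] [IsTopologicalGroup G]
  {H : Subgroup G} [MeasurableSpace (G ⧸ H)] [BorelSpace (G ⧸ H)]
  (m : StronglyQuasiInvariantMeasure G (G ⧸ H))

/-- Multiplication of a compactly supported function by the density `rho`. -/
noncomputable def mulRho (F : C_c(G, ℝ)) : C_c(G, ℝ) :=
  ⟨⟨fun x => m.rho x * F x, m.continuous_rho.mul F.continuous⟩, F.hasCompactSupport.mul_left⟩

@[simp] theorem mulRho_apply (F : C_c(G, ℝ)) (x : G) : m.mulRho F x = m.rho x * F x := rfl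

theorem rho_one : m.rho 1 = 1 := by
  have h := m.rho_mul_subgroup 1 1
  simp only [OneMemClass.coe_one, mul_one] at h
  exact (mul_eq_left₀ (m.rho_pos 1).ne').1 h.symm

theorem rho_mul_rho_inv (k : H) : m.rho k * m.rho (k⁻¹ : H) = 1 := by
  rw [← rho_mul_subgroup, ← rho_one m]
  simp

variable [LocallyCompactSpace G] [T2Space G] [MeasurableSpace G] [BorelSpace G]

/-- An `H`-invariant equivariant family, paired with `rho * B`, is controlled by the norm of the
fibre integral of `B`. -/
theorem abs_apply_mulRho_le [LocallyCompactSpace H] (hH : IsClosed (H : Set G))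
    (η : Measure H) [IsHaarMeasure η] {ν : Measure G} [IsHaarMeasure ν]
    (hν : ∀ F : G → ℝ, Continuous F → HasCompactSupport F →
      ∫ x, m.rho x * F x ∂ν = ∫ q, quotientIntegral η F q ∂m.μ)
    {T : C_c(G, ℝ) × (H →ᵇ ℝ) → ℝ} (hT : IsEquivariantFamily H ν T)
    (hinv : ∀ (h : H) F φ,
      modularCharacterFun (h : G) * T (rightTranslate (h : G) F, φ) = T (F, φ))
    {φ : H →ᵇ ℝ} (hφ : 0 ≤ φ) (B : C_c(G, ℝ)) :
    |T (m.mulRho B, φ)| ≤ ‖φ‖ * ∫ q, |quotientIntegral η B q| ∂m.μ := by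
  let L : C_c(G, ℝ) →ₗ[ℝ] ℝ :=
    { toFun := fun F => T (m.mulRho F, φ)
      map_add' := fun F F' => by
        rw [← hT.add_left]; congr; ext x; simp [mul_add]
      map_smul' := fun c F => by
        rw [RingHom.id_apply, smul_eq_mul, ← hT.smul_left]; congr; ext x; simp [mul_left_comm] }
  let Λ : C_c(G, ℝ) →ₚ[ℝ] ℝ := PositiveLinearMap.mk₀ L fun F hF =>
    hT.nonneg _ _ (fun x => mul_nonneg (m.rho_pos x).le (hF x)) hφ
  let κ := RealRMK.rieszMeasure Λ
  have hκ : ∀ F : C_c(G, ℝ), ∫ x, F x ∂κ = T (m.mulRho F, φ) := fun F =>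
    RealRMK.integral_rieszMeasure Λ F
  have hreg : κ.Regular := RealRMK.regular_rieszMeasure Λ
  -- Invariance of `T` contributes Δ_G(k) and the density contributes ρ(k)⁻¹; their product is
  -- Δ_H(k), the scaling under which fibre integration is symmetric.
  have hmod : ∀ F : G → ℝ, Continuous F → HasCompactSupport F → ∀ k : H,
      ∫ x, F (x * k) ∂κ = modularCharacterFun k * ∫ x, F x ∂κ := by
    intro F hF hFc k
    let F₀ : C_c(G, ℝ) := ⟨⟨F, hF⟩, hFc⟩
    have h1 : ∫ x, F (x * k) ∂κ = ∫ x, rightTranslate ((k⁻¹ : H) : G) F₀ x ∂κ := by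
      simp [F₀]
    have h2 : m.mulRho (rightTranslate ((k⁻¹ : H) : G) F₀) =
        rightTranslate ((k⁻¹ : H) : G) (m.rho (k⁻¹ : H) • m.mulRho F₀) := by
      ext x
      have h3 : m.rho (x * k) = m.rho x * m.rho k := m.rho_mul_subgroup x k
      have h4 := m.rho_mul_rho_inv k
      simp only [mulRho_apply, rightTranslate_apply, CompactlySupportedContinuousMap.smul_apply,
        smul_eq_mul, InvMemClass.coe_inv, inv_inv, h3] at h4 ⊢
      linear_combination (-m.rho x * F₀ (x * k)) * h4
    have h5 := hinv k⁻¹ (m.rho (k⁻¹ : H) • m.mulRho F₀) φ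
    have h6 := m.rho_mul_modularCharacterFun hH η hν k
    have h7 := modularCharacterFun_inv_mul_self (k : G)
    have h8 := m.rho_mul_rho_inv k
    have h9 : ∫ x, F x ∂κ = T (m.mulRho F₀, φ) := hκ F₀
    rw [h1, hκ, h2, h9]
    rw [hT.smul_left] at h5
    rw [InvMemClass.coe_inv] at h5 h8 ⊢
    generalize T (rightTranslate (k : G)⁻¹ (m.rho (k : G)⁻¹ • m.mulRho F₀), φ) = a at *
    generalize T (m.mulRho F₀, φ) = b at *
    calc a = (modularCharacterFun (k : G)⁻¹ * modularCharacterFun (k : G) : ℝ) * a := by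
          rw [h7, one_mul]
      _ = modularCharacterFun (k : G) * (m.rho (k : G)⁻¹ * b) := by rw [← h5]; ring
      _ = modularCharacterFun k * (m.rho k * m.rho (k : G)⁻¹) * b := by rw [← h6]; ring
      _ = _ := by rw [h8, mul_one]
  obtain ⟨β, hβ, hβc, hβ0, hβ1, hβB⟩ := exists_fiberIntegral_eq_one hH η B.hasCompactSupport
  have hBc := continuous_fiberIntegral hH η (F := B) B.continuous B.hasCompactSupport
  -- Since the fibre integral of `β` is 1 on the support of `B`, symmetry moves the fibre integral
  -- onto `B`. Absolute values are taken only afterwards, so cancellation along the fibres is kept.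
  let A : C_c(G, ℝ) := ⟨⟨fun x => |fiberIntegral η B x| * β x, hBc.abs.mul hβ⟩, hβc.mul_left⟩
  calc |T (m.mulRho B, φ)| = |∫ x, B x * fiberIntegral η β x ∂κ| := by
        rw [← hκ]
        congr 1
        refine integral_congr_ae (.of_forall fun x => ?_)
        by_cases hx : B x = 0
        · simp [hx]
        · simp [hβB x (subset_tsupport _ hx)]
    _ = |∫ x, fiberIntegral η B x * β x ∂κ| := by
        rw [integral_mul_fiberIntegral_comm hH η κ hmod (F := B) B.continuous
          B.hasCompactSupport hβ hβc]
    _ ≤ ∫ x, |fiberIntegral η B x * β x| ∂κ := abs_integral_le_integral_abs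
    _ = ∫ x, A x ∂κ := by
        refine integral_congr_ae (.of_forall fun x => ?_)
        simp only [abs_mul, abs_of_nonneg (hβ0 x), A]
        rfl
    _ = T (m.mulRho A, φ) := hκ A
    _ ≤ ‖φ‖ * ∫ x, |m.mulRho A x| ∂ν := (le_abs_self _).trans (hT.bound _ _)
    _ = ‖φ‖ * ∫ x, m.rho x * A x ∂ν := by
        congr 1
        refine integral_congr_ae (.of_forall fun x => ?_)
        exact abs_of_nonneg (mul_nonneg (m.rho_pos x).le (mul_nonneg (abs_nonneg _) (hβ0 x)))
    _ = ‖φ‖ * ∫ q, quotientIntegral η A q ∂m.μ := by rw [hν A A.continuous A.hasCompactSupport]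
    _ ≤ _ := by
        refine mul_le_mul_of_nonneg_left (integral_mono
          (m.integrable_quotientIntegral hH η A.continuous A.hasCompactSupport)
          (m.integrable_quotientIntegral hH η B.continuous B.hasCompactSupport).abs
          fun q => ?_) (norm_nonneg _)
        obtain ⟨x, rfl⟩ := QuotientGroup.mk_surjective q
        have h := fiberIntegral_mul_comp_mk η β (fun q => |quotientIntegral η B q|) x
        simp only [quotientIntegral_mk] at h ⊢
        have h2 : (A : G → ℝ) = fun y => β y * |fiberIntegral η B y| := by
          funext y; exact mul_comm _ _
        rw [h2, h]
        exact mul_le_of_le_one_left (abs_nonneg _) (hβ1 x)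

end StronglyQuasiInvariantMeasure

/-! ### Almost invariant functions on `G ⧸ H` -/

/-- A weighted arithmetic-geometric mean bound. Once integrated and summed it replaces the
Cauchy–Schwarz inequality, with `t` chosen at the end. -/
theorem abs_normSq_sub_normSq_le (a b : ℂ) {t : ℝ} (ht : 0 < t) :
    |‖a‖ ^ 2 - ‖b‖ ^ 2| ≤ 1 / (2 * t) * ‖a - b‖ ^ 2 + t * (‖a‖ ^ 2 + ‖b‖ ^ 2) := by
  have h1 : |‖a‖ ^ 2 - ‖b‖ ^ 2| ≤ ‖a - b‖ * (‖a‖ + ‖b‖) := by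
    rw [sq_sub_sq, abs_mul, mul_comm, abs_of_nonneg (by positivity : 0 ≤ ‖a‖ + ‖b‖)]
    exact mul_le_mul_of_nonneg_right (abs_norm_sub_norm_le a b) (by positivity)
  refine h1.trans ?_
  have h2 : 1 / (2 * t) * ‖a - b‖ ^ 2 + t * (‖a‖ ^ 2 + ‖b‖ ^ 2) - ‖a - b‖ * (‖a‖ + ‖b‖) =
      1 / (2 * t) * (‖a - b‖ - t * (‖a‖ + ‖b‖)) ^ 2 + t / 2 * (‖a‖ - ‖b‖) ^ 2 := by
    field_simp
    ring
  have h3 : 0 ≤ 1 / (2 * t) * (‖a - b‖ - t * (‖a‖ + ‖b‖)) ^ 2 + t / 2 * (‖a‖ - ‖b‖) ^ 2 := by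
    positivity
  linarith

section L2

variable {X : Type u} [MeasurableSpace X] {μ : Measure X}

theorem integrable_norm_sq_Lp (f : Lp ℂ 2 μ) : Integrable (fun x => ‖f x‖ ^ 2) μ :=
  (Lp.memLp f).integrable_norm_pow (by simp)

theorem integral_norm_sq_Lp (f : Lp ℂ 2 μ) : ∫ x, ‖f x‖ ^ 2 ∂μ = ‖f‖ ^ 2 := by
  have h : ((‖f‖ ^ 2 : ℝ) : ℂ) = ((∫ x, ‖f x‖ ^ 2 ∂μ : ℝ) : ℂ) := by
    have h1 : inner ℂ f f = ((‖f‖ : ℝ) : ℂ) ^ 2 := inner_self_eq_norm_sq_to_K f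
    rw [Complex.ofReal_pow, ← h1, L2.inner_def, ← integral_complex_ofReal]
    refine integral_congr_ae (.of_forall fun x => ?_)
    have h2 : inner ℂ (f x) (f x) = ((‖f x‖ : ℝ) : ℂ) ^ 2 := inner_self_eq_norm_sq_to_K (f x)
    simp only [h2, Complex.ofReal_pow]
  exact_mod_cast h.symm

end L2

section Density

/-- In a locally compact Hausdorff space, compactly supported continuous functions are dense in the
integrable functions. -/
theorem exists_hasCompactSupport_integral_abs_sub_le {X : Type u} [TopologicalSpace X] [T2Space X]
    [LocallyCompactSpace X] [MeasurableSpace X] [BorelSpace X] {μ : Measure X} [μ.Regular]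
    {f : X → ℝ} (hf : Integrable f μ) {ε : ℝ} (hε : 0 < ε) :
    ∃ g : X → ℝ, Continuous g ∧ HasCompactSupport g ∧ Integrable g μ ∧
      ∫ x, |f x - g x| ∂μ ≤ ε := by
  obtain ⟨g, hg, hgc, hgk⟩ : ∃ g : X → ℝ, eLpNorm (f - g) 1 μ ≤ ENNReal.ofReal ε ∧
      Continuous g ∧ HasCompactSupport g := by
    apply (memLp_one_iff_integrable.2 hf).induction_dense ENNReal.one_ne_top _ ?_ ?_ ?_
      (ENNReal.ofReal_pos.2 hε).ne'
    rotate_left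
    · rintro f g ⟨hf, hfk⟩ ⟨hg, hgk⟩
      exact ⟨hf.add hg, hfk.add hgk⟩
    · rintro g ⟨hg, hgk⟩
      exact (hg.integrable_of_hasCompactSupport hgk).aestronglyMeasurable
    intro c t ht htμ ε hε
    obtain ⟨η, hη, hηε⟩ := exists_eLpNorm_indicator_le (μ := μ) ENNReal.one_ne_top c hε
    have hη2 : ((η / 2 : ℝ≥0) : ℝ≥0∞) ≠ 0 := by simpa using hη.ne'
    obtain ⟨s, hst, hs, hsη⟩ := ht.exists_isCompact_sdiff_lt htμ.ne hη2
    obtain ⟨V, hsV, hV, -, hVη⟩ := hs.measurableSet.exists_isOpen_sdiff_lt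
      (hs.measure_lt_top (μ := μ)).ne hη2
    obtain ⟨b, hb1, hb0, hbc, hb01⟩ := exists_continuous_one_zero_of_isCompact hs
      hV.isClosed_compl (Set.disjoint_compl_right_iff_subset.2 hsV)
    -- The bump agrees with the indicator of `t` on `s` and outside `V ∪ t`, so the error lives on
    -- two sets of small measure.
    refine ⟨fun x => b x * c, ?_, by fun_prop, hbc.mul_right⟩
    refine le_trans (eLpNorm_mono (g := ((V \ s) ∪ (t \ s)).indicator fun _ => c) fun x => ?_)
      (hηε _ ?_)
    · have hbc : ‖b x * c‖ ≤ ‖c‖ := by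
        rw [norm_mul, Real.norm_of_nonneg (hb01 x).1]
        exact mul_le_of_le_one_left (norm_nonneg _) (hb01 x).2
      have hbc' : ‖b x * c - c‖ ≤ ‖c‖ := by
        rw [show b x * c - c = -((1 - b x) * c) by ring, norm_neg, norm_mul,
          Real.norm_of_nonneg (sub_nonneg.2 (hb01 x).2)]
        exact mul_le_of_le_one_left (norm_nonneg _) (by linarith [(hb01 x).1])
      by_cases hxs : x ∈ s
      · simp [hb1 hxs, hst hxs]
      · by_cases hxt : x ∈ t
        · simpa [hxs, hxt] using hbc'
        · by_cases hxV : x ∈ V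
          · simpa [hxs, hxt, hxV] using hbc
          · simp [hb0 (show x ∈ Vᶜ from hxV), hxt]
    · calc μ ((V \ s) ∪ (t \ s)) ≤ (η / 2 : ℝ≥0) + (η / 2 : ℝ≥0) :=
            (measure_union_le _ _).trans (add_le_add hVη.le hsη.le)
        _ = η := by rw [← ENNReal.coe_add, add_halves]
  have hgi : Integrable g μ := hgc.integrable_of_hasCompactSupport hgk
  refine ⟨g, hgc, hgk, hgi, ?_⟩
  have h := (hf.sub hgi)
  change ∫ x, ‖(f - g) x‖ ∂μ ≤ ε
  rw [integral_norm_eq_lintegral_enorm h.aestronglyMeasurable, ← eLpNorm_one_eq_lintegral_enorm]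
  exact ENNReal.toReal_le_of_le_ofReal hε.le hg

end Density

/-! ### From almost invariant vectors to almost invariant densities -/

namespace StronglyQuasiInvariantMeasure

open Measure

variable {G : Type u} [Group G] [TopologicalSpace G] {X : Type v} [TopologicalSpace X]
  [MulAction G X] [ContinuousConstSMul G X] [MeasurableSpace X] [BorelSpace X]
  (m : StronglyQuasiInvariantMeasure G X)

/-- Squaring moduli turns the quasi-regular representation on L² into the isometric action on L¹ by
transported densities. -/
theorem norm_sq_quasiRegular_ae (g : G) (f : Lp ℂ 2 m.μ) :
    (fun q => ‖m.quasiRegular g f q‖ ^ 2) =ᵐ[m.μ]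
      fun q => m.cocycle g⁻¹ q * ‖f (g⁻¹ • q)‖ ^ 2 := by
  filter_upwards [m.coeFn_translateLp g f] with q hq
  have h : m.quasiRegular g f q = m.translate g f q := hq
  rw [h, translate, norm_mul, mul_pow]
  simp [abs_of_nonneg]

theorem integral_abs_norm_sq_quasiRegular_sub_le (g : G) (f : Lp ℂ 2 m.μ) {t : ℝ} (ht : 0 < t) :
    ∫ q, |m.cocycle g⁻¹ q * ‖f (g⁻¹ • q)‖ ^ 2 - ‖f q‖ ^ 2| ∂m.μ ≤
      1 / (2 * t) * ‖m.quasiRegular g f - f‖ ^ 2 + 2 * t * ‖f‖ ^ 2 := by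
  have hi1 := integrable_norm_sq_Lp (m.quasiRegular g f - f)
  have hi2 := integrable_norm_sq_Lp (m.quasiRegular g f)
  have hi3 := integrable_norm_sq_Lp f
  calc ∫ q, |m.cocycle g⁻¹ q * ‖f (g⁻¹ • q)‖ ^ 2 - ‖f q‖ ^ 2| ∂m.μ
      ≤ ∫ q, (1 / (2 * t) * ‖(m.quasiRegular g f - f) q‖ ^ 2 +
          t * (‖m.quasiRegular g f q‖ ^ 2 + ‖f q‖ ^ 2)) ∂m.μ := by
        refine integral_mono_ae
          ((m.integrable_cocycle_mul g⁻¹ hi3).sub hi3).abs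
          ((hi1.const_mul _).add ((hi2.add hi3).const_mul _)) ?_
        filter_upwards [m.norm_sq_quasiRegular_ae g f, Lp.coeFn_sub (m.quasiRegular g f) f]
          with q hq1 hq2
        rw [← hq1, hq2]
        exact abs_normSq_sub_normSq_le _ _ ht
    _ = _ := by
        have h := integral_add (hi1.const_mul (1 / (2 * t))) ((hi2.add hi3).const_mul t)
        simp only [Pi.add_apply] at h
        rw [h, integral_const_mul, integral_const_mul, integral_add hi2 hi3]
        simp only [integral_norm_sq_Lp, LinearIsometryEquiv.norm_map]
        ring

/-- If the trivial representation of `H` is weakly contained in the quasi-regular representation,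
then there are almost `H`-invariant densities. -/
theorem exists_almost_invariant_integrable {H : Subgroup G}
    (hD : WeaklyContained (trivialRep H) (m.quasiRegular.comp H.subtype)) (Q : Finset H) {ε : ℝ}
    (hε : 0 < ε) : ∃ f : X → ℝ, Integrable f m.μ ∧ 0 ≤ f ∧ |∫ q, f q ∂m.μ - 1| ≤ ε ∧
      ∀ h ∈ Q, ∫ q, |m.cocycle (h : G)⁻¹ q * f ((h : G)⁻¹ • q) - f q| ∂m.μ ≤ ε := by
  classical
  obtain ⟨δ, hδ, hδ1, hδε, hδε2⟩ : ∃ δ > 0, δ ≤ 1 ∧ δ ≤ ε ∧ δ ≤ ε ^ 2 / 32 :=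
    ⟨min 1 (min ε (ε ^ 2 / 32)), by positivity, min_le_left _ _,
      (min_le_right _ _).trans (min_le_left _ _), (min_le_right _ _).trans (min_le_right _ _)⟩
  -- The identity is included to control the total mass of the squared norms; no single vector need
  -- be almost invariant, only the whole family.
  obtain ⟨n, η, hη⟩ := hD 1 (insert 1 (Q : Set H)) (Q.finite_toSet.insert 1).isCompact δ hδ
  have htriv : ∀ h : H, inner ℂ (1 : ℂ) (trivialRep H h 1) = 1 := by
    intro h; simp [trivialRep]
  simp only [htriv] at hη
  have hre : ∀ h : H, h ∈ insert 1 (Q : Set H) →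
      |1 - ∑ i, (inner ℂ (η i) (m.quasiRegular h (η i))).re| < δ := by
    intro h hh
    refine lt_of_le_of_lt ?_ (hη h hh)
    have := Complex.abs_re_le_norm
      (1 - ∑ i, inner ℂ (η i) ((m.quasiRegular.comp H.subtype) h (η i)))
    simpa using this
  have h1 : |1 - ∑ i, ‖η i‖ ^ 2| < δ := by
    have := hre 1 (Set.mem_insert _ _)
    have h2 : ∀ i, (inner ℂ (η i) (m.quasiRegular ((1 : H) : G) (η i))).re = ‖η i‖ ^ 2 := by
      intro i
      have h3 : inner ℂ (η i) (η i) = ((‖η i‖ : ℝ) : ℂ) ^ 2 := inner_self_eq_norm_sq_to_K (η i)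
      rw [OneMemClass.coe_one, map_one, LinearIsometryEquiv.coe_one, id_eq, h3, ← Complex.ofReal_pow,
        Complex.ofReal_re]
    simpa only [h2] using this
  have hint : ∫ q, ∑ i, ‖η i q‖ ^ 2 ∂m.μ = ∑ i, ‖η i‖ ^ 2 := by
    rw [integral_finsetSum _ fun i _ => integrable_norm_sq_Lp (η i)]
    simp only [integral_norm_sq_Lp]
  refine ⟨fun q => ∑ i, ‖η i q‖ ^ 2, integrable_finsetSum _ fun i _ => integrable_norm_sq_Lp (η i),
    fun q => Finset.sum_nonneg fun i _ => by positivity, ?_, fun h hh => ?_⟩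
  · rw [hint, abs_sub_comm]
    exact h1.le.trans hδε
  -- With t = ε/8, a total squared displacement of at most 4δ ≤ ε²/8 and total mass at most 2, each
  -- of the two error terms is at most ε/2.
  · have ht : (0 : ℝ) < ε / 8 := by positivity
    have h2 := hre h (Set.mem_insert_of_mem _ hh)
    have h3 : ∑ i, ‖m.quasiRegular h (η i) - η i‖ ^ 2 ≤ 4 * δ := by
      have h4 : ∀ i, ‖m.quasiRegular h (η i) - η i‖ ^ 2 =
          2 * ‖η i‖ ^ 2 - 2 * (inner ℂ (η i) (m.quasiRegular h (η i))).re := by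
        intro i
        rw [← norm_neg, neg_sub, norm_sub_sq (𝕜 := ℂ), LinearIsometryEquiv.norm_map]
        simp only [RCLike.re_to_complex]
        ring
      simp only [h4, Finset.sum_sub_distrib, ← Finset.mul_sum]
      rw [abs_lt] at h1 h2
      linarith
    have hi : ∀ i, Integrable (fun q => |m.cocycle (h : G)⁻¹ q * ‖η i ((h : G)⁻¹ • q)‖ ^ 2 -
        ‖η i q‖ ^ 2|) m.μ := fun i =>
      ((m.integrable_cocycle_mul _ (integrable_norm_sq_Lp (η i))).sub
        (integrable_norm_sq_Lp (η i))).abs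
    calc ∫ q, |m.cocycle (h : G)⁻¹ q * ∑ i, ‖η i ((h : G)⁻¹ • q)‖ ^ 2 - ∑ i, ‖η i q‖ ^ 2| ∂m.μ
        ≤ ∫ q, ∑ i, |m.cocycle (h : G)⁻¹ q * ‖η i ((h : G)⁻¹ • q)‖ ^ 2 - ‖η i q‖ ^ 2| ∂m.μ := by
          refine integral_mono_of_nonneg (.of_forall fun q => abs_nonneg _)
            (integrable_finsetSum _ fun i _ => hi i) (.of_forall fun q => ?_)
          simp only [Finset.mul_sum, ← Finset.sum_sub_distrib]
          exact Finset.abs_sum_le_sum_abs _ _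
      _ = ∑ i, ∫ q, |m.cocycle (h : G)⁻¹ q * ‖η i ((h : G)⁻¹ • q)‖ ^ 2 - ‖η i q‖ ^ 2| ∂m.μ :=
          integral_finsetSum _ fun i _ => hi i
      _ ≤ ∑ i, (1 / (2 * (ε / 8)) * ‖m.quasiRegular h (η i) - η i‖ ^ 2 +
            2 * (ε / 8) * ‖η i‖ ^ 2) :=
          Finset.sum_le_sum fun i _ => m.integral_abs_norm_sq_quasiRegular_sub_le _ _ ht
      _ = 1 / (2 * (ε / 8)) * ∑ i, ‖m.quasiRegular h (η i) - η i‖ ^ 2 +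
            2 * (ε / 8) * ∑ i, ‖η i‖ ^ 2 := by
          rw [Finset.sum_add_distrib, Finset.mul_sum, Finset.mul_sum]
      _ ≤ 1 / (2 * (ε / 8)) * (4 * (ε ^ 2 / 32)) + 2 * (ε / 8) * 2 := by
          rw [abs_lt] at h1
          gcongr <;> linarith
      _ = ε := by field_simp; ring

/-- Almost `H`-invariant densities can be taken continuous and compactly supported. -/
theorem exists_almost_invariant_continuous [T2Space X] [LocallyCompactSpace X] {H : Subgroup G}
    (hD : WeaklyContained (trivialRep H) (m.quasiRegular.comp H.subtype)) (Q : Finset H) {ε : ℝ}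
    (hε : 0 < ε) : ∃ f : X → ℝ, Continuous f ∧ HasCompactSupport f ∧ 0 ≤ f ∧
      ∫ q, f q ∂m.μ = 1 ∧
      ∀ h ∈ Q, ∫ q, |m.cocycle (h : G)⁻¹ q * f ((h : G)⁻¹ • q) - f q| ∂m.μ ≤ ε := by
  have := m.regular
  obtain ⟨δ, hδ, hδ4, hδε⟩ : ∃ δ > 0, δ ≤ 1 / 4 ∧ δ ≤ ε / 6 :=
    ⟨min (1 / 4) (ε / 6), by positivity, min_le_left _ _, min_le_right _ _⟩
  obtain ⟨f₀, hf₀, hf₀0, hf₀1, hf₀Q⟩ := m.exists_almost_invariant_integrable hD Q hδ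
  obtain ⟨g, hg, hgc, hgi, hgf⟩ := exists_hasCompactSupport_integral_abs_sub_le hf₀ hδ
  obtain ⟨a, ha, hac, ha0, hai, hdist⟩ : ∃ a : X → ℝ, Continuous a ∧ HasCompactSupport a ∧
      0 ≤ a ∧ Integrable a m.μ ∧ ∫ q, |f₀ q - a q| ∂m.μ ≤ δ := by
    refine ⟨fun q => |g q|, hg.abs, hgc.comp_left abs_zero, fun q => abs_nonneg _, hgi.abs, ?_⟩
    refine (integral_mono (hf₀.sub hgi.abs).abs (hf₀.sub hgi).norm fun q => ?_).trans hgf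
    have := abs_abs_sub_abs_le (f₀ q) (g q)
    rwa [abs_of_nonneg (hf₀0 q)] at this
  have hN : 1 / 2 ≤ ∫ q, a q ∂m.μ := by
    have h1 : ∫ q, f₀ q ∂m.μ - ∫ q, a q ∂m.μ ≤ δ := by
      rw [← integral_sub hf₀ hai]
      exact (le_abs_self _).trans (abs_integral_le_integral_abs.trans hdist)
    rw [abs_le] at hf₀1
    linarith
  have hN0 : 0 < ∫ q, a q ∂m.μ := by linarith
  refine ⟨fun q => (∫ q, a q ∂m.μ)⁻¹ * a q, by fun_prop,
    hac.mul_left, fun q => mul_nonneg (inv_nonneg.2 hN0.le) (ha0 q), ?_, fun h hh => ?_⟩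
  · rw [integral_const_mul, inv_mul_cancel₀ hN0.ne']
  · have hi1 : Integrable (fun q => |f₀ q - a q|) m.μ := (hf₀.sub hai).abs
    have hi2 : Integrable (fun q => m.cocycle (h : G)⁻¹ q *
        |f₀ ((h : G)⁻¹ • q) - a ((h : G)⁻¹ • q)|) m.μ := m.integrable_cocycle_mul (h : G)⁻¹ hi1
    have hi3 : Integrable (fun q => |m.cocycle (h : G)⁻¹ q * f₀ ((h : G)⁻¹ • q) - f₀ q|) m.μ :=
      ((m.integrable_cocycle_mul (h : G)⁻¹ hf₀).sub hf₀).abs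
    have hi4 : Integrable (fun q => |m.cocycle (h : G)⁻¹ q * a ((h : G)⁻¹ • q) - a q|) m.μ :=
      ((m.integrable_cocycle_mul (h : G)⁻¹ hai).sub hai).abs
    -- One δ for each of the two replacements of `f₀` by `a` (the transported one has the same
    -- integral) and one for `f₀` itself. Normalizing at most doubles this, whence δ ≤ ε/6.
    have hmain : ∫ q, |m.cocycle (h : G)⁻¹ q * a ((h : G)⁻¹ • q) - a q| ∂m.μ ≤ 3 * δ := by
      calc ∫ q, |m.cocycle (h : G)⁻¹ q * a ((h : G)⁻¹ • q) - a q| ∂m.μ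
          ≤ ∫ q, (m.cocycle (h : G)⁻¹ q * |f₀ ((h : G)⁻¹ • q) - a ((h : G)⁻¹ • q)| +
              |m.cocycle (h : G)⁻¹ q * f₀ ((h : G)⁻¹ • q) - f₀ q| + |f₀ q - a q|) ∂m.μ := by
            refine integral_mono hi4 ((hi2.add hi3).add hi1) fun q => ?_
            simp only
            have hc : (0 : ℝ) ≤ m.cocycle (h : G)⁻¹ q := NNReal.coe_nonneg _
            rw [← abs_of_nonneg hc, ← abs_mul, abs_of_nonneg hc]
            refine le_trans (le_of_eq ?_) ((abs_add_three (-(m.cocycle (h : G)⁻¹ q *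
              (f₀ ((h : G)⁻¹ • q) - a ((h : G)⁻¹ • q))))
              (m.cocycle (h : G)⁻¹ q * f₀ ((h : G)⁻¹ • q) - f₀ q) (f₀ q - a q)).trans_eq ?_)
            · congr 1; ring
            · rw [abs_neg]
        _ = (∫ q, |f₀ q - a q| ∂m.μ) +
              (∫ q, |m.cocycle (h : G)⁻¹ q * f₀ ((h : G)⁻¹ • q) - f₀ q| ∂m.μ) +
              ∫ q, |f₀ q - a q| ∂m.μ := by
            have h1 := integral_add (hi2.add hi3) hi1
            simp only [Pi.add_apply] at h1
            rw [h1, integral_add hi2 hi3,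
              m.integral_cocycle_mul (h : G)⁻¹ fun q => |f₀ q - a q|]
        _ ≤ 3 * δ := by linarith [hf₀Q h hh]
    have hfac : ∀ q, |m.cocycle (h : G)⁻¹ q * ((∫ q, a q ∂m.μ)⁻¹ * a ((h : G)⁻¹ • q)) -
        (∫ q, a q ∂m.μ)⁻¹ * a q| = (∫ q, a q ∂m.μ)⁻¹ *
        |m.cocycle (h : G)⁻¹ q * a ((h : G)⁻¹ • q) - a q| := by
      intro q
      rw [← abs_of_pos (inv_pos.2 hN0), ← abs_mul, abs_of_pos (inv_pos.2 hN0)]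
      congr 1
      ring
    simp only [hfac, integral_const_mul]
    calc (∫ q, a q ∂m.μ)⁻¹ * ∫ q, |m.cocycle (h : G)⁻¹ q * a ((h : G)⁻¹ • q) - a q| ∂m.μ
        ≤ (1 / 2 : ℝ)⁻¹ * (3 * δ) := by
          gcongr
      _ ≤ ε := by norm_num; linarith

end StronglyQuasiInvariantMeasure

/-! ### The main theorem -/

section Main

open Measure
open scoped CompactlySupported

variable {G : Type u} [Group G] [TopologicalSpace G] [IsTopologicalGroup G]
  [LocallyCompactSpace G] [T2Space G] [MeasurableSpace G] [BorelSpace G]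
  {H : Subgroup G} [LocallyCompactSpace H] [MeasurableSpace (G ⧸ H)] [BorelSpace (G ⧸ H)]

/-- Pairing an `H`-invariant equivariant family with a density on `G ⧸ H` gives a mean on `H`
which is as invariant as the density is. -/
theorem exists_approximately_invariant_mean (hH : IsClosed (H : Set G))
    (m : StronglyQuasiInvariantMeasure G (G ⧸ H))
    (η : Measure H) [IsHaarMeasure η] {ν : Measure G} [IsHaarMeasure ν]
    (hν : ∀ F : G → ℝ, Continuous F → HasCompactSupport F →
      ∫ x, m.rho x * F x ∂ν = ∫ q, quotientIntegral η F q ∂m.μ)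
    {T : C_c(G, ℝ) × (H →ᵇ ℝ) → ℝ} (hT : T ∈ inducedSet H ν)
    (hinv : ∀ (h : H) F φ,
      modularCharacterFun (h : G) * T (rightTranslate (h : G) F, φ) = T (F, φ))
    {f : G ⧸ H → ℝ} (hf : Continuous f) (hfc : HasCompactSupport f) (hf0 : 0 ≤ f)
    (hf1 : ∫ q, f q ∂m.μ = 1) :
    ∃ M : (H →ᵇ ℝ) →ₗ[ℝ] ℝ, (∀ φ, 0 ≤ φ → 0 ≤ M φ) ∧ M 1 = 1 ∧ ∀ (h : H) φ,
      |M (translateBounded h φ) - M φ| ≤ 2 *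
        (∫ q, |m.cocycle (h : G)⁻¹ q * f ((h : G)⁻¹ • q) - f q| ∂m.μ) * ‖φ‖ := by
  obtain ⟨hT, hT1⟩ := hT
  obtain ⟨F', hF', hFc', hF0, hFf⟩ := exists_fiberIntegral_eq hH η hf hfc hf0
  let F : C_c(G, ℝ) := ⟨⟨F', hF'⟩, hFc'⟩
  let M : (H →ᵇ ℝ) →ₗ[ℝ] ℝ :=
    { toFun := fun φ => T (m.mulRho F, φ)
      map_add' := hT.add_right _
      map_smul' := fun c φ => hT.smul_right c _ φ }
  have hM : ∀ φ, M φ = T (m.mulRho F, φ) := fun φ => rfl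
  have hFq : ∀ q, quotientIntegral η F q = f q := by
    intro q
    obtain ⟨x, rfl⟩ := QuotientGroup.mk_surjective q
    rw [quotientIntegral_mk]
    exact hFf x
  have hM1 : M 1 = 1 := by
    rw [hM, hT1]
    simp only [StronglyQuasiInvariantMeasure.mulRho_apply]
    rw [hν F F.continuous F.hasCompactSupport]
    simp only [hFq, hf1]
  have hpos : ∀ (h : H) φ, 0 ≤ φ → |M (translateBounded h φ) - M φ| ≤ ‖φ‖ *
      ∫ q, |m.cocycle (h : G)⁻¹ q * f ((h : G)⁻¹ • q) - f q| ∂m.μ := by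
    intro h φ hφ
    have hc : Continuous fun x : G => (m.cocycle (h : G)⁻¹ (x : G ⧸ H) : ℝ) :=
      NNReal.continuous_coe.comp
        ((m.continuous_cocycle_right _).comp QuotientGroup.continuous_mk)
    let A : C_c(G, ℝ) := ⟨⟨fun x => F ((h : G)⁻¹ * x) * m.cocycle (h : G)⁻¹ (x : G ⧸ H),
      (F.continuous.comp (by fun_prop)).mul hc⟩,
      (hasCompactSupport_mul_left F.hasCompactSupport _).mul_right⟩
    -- By equivariance, translating φ by `h` translates ρF on the left; the cocycle identity
    -- rewrites the difference as ρB, and the fibre integral of `B` is the defect of invariance of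
    -- `f`.
    let B : C_c(G, ℝ) := A + (-1 : ℝ) • F
    have h1 : M (translateBounded h φ) - M φ = T (m.mulRho B, φ) := by
      have h2 : m.mulRho B = leftTranslate (h : G) (m.mulRho F) + (-1 : ℝ) • m.mulRho F := by
        ext x
        have h3 := m.rho_mul (h : G)⁻¹ x
        simp only [B, A, StronglyQuasiInvariantMeasure.mulRho_apply, leftTranslate_apply,
          CompactlySupportedContinuousMap.add_apply, CompactlySupportedContinuousMap.smul_apply,
          smul_eq_mul, h3]
        simp only [CompactlySupportedContinuousMap.coe_mk, ContinuousMap.coe_mk]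
        ring
      rw [hM, hM, h2, hT.add_left, hT.smul_left, hT.equivariant]
      ring
    have h4 : ∀ q, quotientIntegral η B q =
        m.cocycle (h : G)⁻¹ q * f ((h : G)⁻¹ • q) - f q := by
      intro q
      obtain ⟨x, rfl⟩ := QuotientGroup.mk_surjective q
      have h5 : (B : G → ℝ) = fun y => A y - F y := by
        funext y
        simp [B, sub_eq_add_neg]
      have h6 := fiberIntegral_mul_comp_mk η (fun y => F ((h : G)⁻¹ * y))
        (fun q => (m.cocycle (h : G)⁻¹ q : ℝ)) x
      have h7 : fiberIntegral η (fun y => F ((h : G)⁻¹ * y)) x = f ((h : G)⁻¹ * x : G) := by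
        rw [← hFf]
        simp only [fiberIntegral, mul_assoc]
        rfl
      rw [quotientIntegral_mk, h5, fiberIntegral_sub hH η (F := A) (F' := F) A.continuous
        A.hasCompactSupport F.continuous F.hasCompactSupport]
      rw [h7] at h6
      exact congrArg₂ (· - ·) (h6.trans (mul_comm _ _)) (hFf x)
    rw [h1]
    simpa only [h4] using m.abs_apply_mulRho_le hH η hν hT hinv hφ B
  refine ⟨M, fun φ hφ => hT.nonneg _ _ (fun x => mul_nonneg (m.rho_pos x).le (hF0 x)) hφ, hM1,
    fun h φ => ?_⟩
  -- The estimate needs φ ≥ 0. Adding a constant leaves the difference of means unchanged and at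
  -- most doubles the norm, hence the factor 2.
  have hφ : 0 ≤ φ + ‖φ‖ • 1 := fun x => by
    have := neg_le_of_abs_le (φ.norm_coe_le_norm x)
    simpa using by linarith
  have h1 := hpos h _ hφ
  have h2 : translateBounded h (φ + ‖φ‖ • 1) = translateBounded h φ + ‖φ‖ • 1 := by
    ext x; simp
  rw [h2, map_add, map_add, add_sub_add_right_eq_sub] at h1
  refine h1.trans ?_
  have h3 : ‖φ + ‖φ‖ • (1 : H →ᵇ ℝ)‖ ≤ 2 * ‖φ‖ := by
    refine (norm_add_le _ _).trans ?_
    rw [norm_smul, norm_norm, norm_one, mul_one, two_mul]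
  calc _ ≤ 2 * ‖φ‖ * ∫ q, |m.cocycle (h : G)⁻¹ q * f ((h : G)⁻¹ • q) - f q| ∂m.μ :=
        mul_le_mul_of_nonneg_right h3 (integral_nonneg fun q => abs_nonneg _)
    _ = _ := by ring

end Main

theorem mainTheorem6 {G : Type u} [Group G] [TopologicalSpace G] [IsTopologicalGroup G]
    [LocallyCompactSpace G] [T2Space G] (H : Subgroup G) (hH : IsClosed (H : Set G))
    (hD : DerighettiCondition H) (hR : RelativelyAmenable.{u, u} H) :
    Amenable.{u, v} H := by
  let _ : MeasurableSpace (G ⧸ H) := borel (G ⧸ H)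
  have : BorelSpace (G ⧸ H) := ⟨rfl⟩
  obtain ⟨m, hm⟩ : ∃ m : StronglyQuasiInvariantMeasure G (G ⧸ H),
    WeaklyContained (trivialRep H) (m.quasiRegular.comp H.subtype) := hD
  borelize G
  have := t2Space_quotient hH
  have hloc : LocallyCompactSpace H := hH.isClosedEmbedding_subtypeVal.locallyCompactSpace
  obtain ⟨ν, hν, -, hweil⟩ :=
    m.exists_haar_integral_rho_mul hH (Measure.haar : Measure H)
  obtain ⟨T, hT, hinv⟩ :=
    exists_invariant_of_relativelyAmenable hH (Measure.haar : Measure H) ν hR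
  refine amenable_of_approximately_invariant_means fun Q ε hε => ?_
  obtain ⟨f, hf, hfc, hf0, hf1, hfQ⟩ := m.exists_almost_invariant_continuous hm Q (half_pos hε)
  obtain ⟨M, hM0, hM1, hM⟩ := exists_approximately_invariant_mean hH m (Measure.haar : Measure H)
    hweil hT hinv hf hfc hf0 hf1
  refine ⟨M, hM0, hM1, fun h hh φ ψ hψ => ?_⟩
  have h1 : ψ = translateBounded h φ := by ext x; exact hψ x
  rw [h1]
  refine (hM h φ).trans (mul_le_mul_of_nonneg_right ?_ (norm_nonneg _))
  linarith [hfQ h hh]
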